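/- Let $d\ge 1$, $\kappa>0$, $\alpha\in(0,1)$, $\delta>0$, and let $\chi\in L^\infty(\mathbb R)$ satisfy $0\le\chi\le 1$, $\operatorname{supp}\chi\subset[-1,1]$ and $\chi\equiv 1$ on $[-\tfrac12,\tfrac12]$. Write $\chi_\delta(y)=\chi(|y|/\delta)$ for $y\in\mathbb R^d$, and for smooth compactly supported $v:\mathbb R^d\to\mathbb R^d$ set $$K_\delta^*[v](x)=-\frac{\kappa}{\delta^{2(1-\alpha)}}\lim_{\varepsilon\to0^+}\int_{\{|y|\ge\varepsilon\}}\chi_\delta(y)\,\frac{v(x)-v(x+y)}{|y|^{d+2\alpha}}\,dy .$$ Let $\mathcal D(\mathbb R^n;\mathbb R^d)$ be the space of smooth compactly supported $\mathbb R^d$-valued functions and $\mathcal D'(\mathbb R^n;\mathbb R^d)$ its dual. A distributional solution of the linear peridynamics model $\partial_{tt}u-K_\delta[u]=0$ with initial data $u_0,v_0\in\mathcal D'(\mathbb R^d;\mathbb R^d)$ is a distribution $u\in\mathcal D'(\mathbb R\times\mathbb R^d;\mathbb R^d)$ with $\operatorname{supp}u\subset[0,\infty)\times\mathbb R^d$ such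 that $$\langle u,\partial_{tt}\varphi-K_\delta^*[\varphi]\rangle=-\langle u_0,\partial_t\varphi(0,\cdot)\rangle+\langle v_0,\varphi(0,\cdot)\rangle\qquad\text{for all }\varphi\in\mathcal D(\mathbb R\times\mathbb R^d;\mathbb R^d),$$ where $K_\delta^*$ acts on the space variable. For $s\in\mathbb R$ let $H^s(\mathbb R^d;\mathbb R^d)$ be the space of $\mathbb R^d$-valued tempered distributions $w$ with $(1+|\xi|^2)^{s/2}\widehat w\in L^2$, normed by the $L^2$ norm of this function. A function $U\in L^1_{\rm loc}((0,\infty);H^s(\mathbb R^d;\mathbb R^d))$ is regarded as the distribution $$\langle u,\varphi\rangle=\int_{(0,\infty)}\langle U(t),\varphi(t,\cdot)\rangle\,dt ,\qquad \varphi\in\mathcal D(\mathbb R\times\mathbb R^d;\mathbb R^d),$$ these integrals being assumed to converge absolutely. Theorem. Let $s\in\mathbb R$, and let $U\in L^1_{\rm loc}((0,\infty);H^s(\mathbb R^d;\mathbb R^d))$ be such that the associated distribution $u$ is a distributional solution of the linear peridynamics model with initial data $(0,0)$. Then $u=0$; that is, $U(t)=0$ for almost every $t\in(0,\infty)$. 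-/

import Mathlib

open Set Filter Topology MeasureTheory
open scoped Distributions SchwartzMap LineDeriv ContDiff Pointwise

noncomputable section

/-- Euclidean space `ℝ^d`. -/
abbrev Rd (d : ℕ) : Type := EuclideanSpace ℝ (Fin d)

/-- The space `𝒟(ℝ × ℝ^d; ℝ^d)` of smooth compactly supported vector fields on space-time. -/
abbrev SpaceTimeTest (d : ℕ) : Type := 𝓓((⊤ : TopologicalSpace.Opens (ℝ × Rd d)), Rd d)

/-- The space `𝒟(ℝ^d; ℝ^d)` of smooth compactly supported vector fields on space. -/
abbrev SpaceTest (d : ℕ) : Type := 𝓓((⊤ : TopologicalSpace.Opens (Rd d)), Rd d)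

/-! ### The peridynamics operator -/

/-- The constitutive data of the linear isotropic peridynamics model. -/
structure PeridynamicsModel where
  /-- the cut-off profile -/
  χ : ℝ → ℝ
  /-- the constitutive constant -/
  κ : ℝ
  /-- the fractional exponent -/
  α : ℝ
  /-- the horizon -/
  δ : ℝ
  χ_measurable : Measurable χ
  χ_nonneg : ∀ r, 0 ≤ χ r
  χ_le_one : ∀ r, χ r ≤ 1
  χ_support : ∀ r, 1 < |r| → χ r = 0
  χ_eq_one : ∀ r, |r| ≤ 1 / 2 → χ r = 1
  κ_pos : 0 < κ
  α_pos : 0 < α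
  α_lt_one : α < 1
  δ_pos : 0 < δ

namespace PeridynamicsModel

variable (P : PeridynamicsModel) {d : ℕ}

/-- The singular weight `χ_δ(y) / |y|^(d + 2 α)`, where `χ_δ(y) = χ(|y| / δ)`. -/
def kernel (y : Rd d) : ℝ :=
  P.χ (‖y‖ / P.δ) / ‖y‖ ^ ((d : ℝ) + 2 * P.α)

/-- The dual peridynamics operator
`K_δ^*[v](x) = - κ / δ^(2 (1 - α)) p.v. ∫ χ_δ(y) (v(x) - v(x + y)) / |y|^(d + 2 α) dy`,
the principal value being the limit as `ε → 0⁺` of the integrals over `|y| ≥ ε`. -/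
def adjointOp (v : Rd d → Rd d) (x : Rd d) : Rd d :=
  -((P.κ / P.δ ^ (2 * (1 - P.α))) •
    limUnder (𝓝[>] (0 : ℝ)) fun ε : ℝ =>
      ∫ y in (Metric.ball (0 : Rd d) ε)ᶜ, P.kernel y • (v x - v (x + y)))

/-! #### The operator preserves test functions -/

lemma kernel_measurable : Measurable (P.kernel : Rd d → ℝ) := by
  unfold kernel
  have := P.χ_measurable
  fun_prop

lemma kernel_nonneg (y : Rd d) : 0 ≤ P.kernel y :=
  div_nonneg (P.χ_nonneg _) (by positivity)

lemma kernel_neg (y : Rd d) : P.kernel (-y) = P.kernel y := by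
  simp [kernel]

lemma kernel_eq_zero {y : Rd d} (hy : P.δ < ‖y‖) : P.kernel y = 0 := by
  have : P.χ (‖y‖ / P.δ) = 0 := by
    apply P.χ_support
    rw [abs_of_nonneg (div_nonneg (norm_nonneg _) P.δ_pos.le), lt_div_iff₀ P.δ_pos]
    simpa using hy
  simp [kernel, this]

lemma kernel_mul_sq_integrable [NeZero d] :
    Integrable (fun y : Rd d => P.kernel y * ‖y‖ ^ 2) := by
  have hd : 1 ≤ Module.finrank ℝ (Rd d) := by
    simpa using Nat.one_le_iff_ne_zero.2 (NeZero.ne d)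
  have hα := P.α_lt_one
  have hm : AEStronglyMeasurable (fun y : Rd d => P.kernel y * ‖y‖ ^ 2) volume := by
    have := P.kernel_measurable (d := d)
    exact (by fun_prop : Measurable fun y : Rd d => P.kernel y * ‖y‖ ^ 2).aestronglyMeasurable
  have h := integrableOn_ball_of_norm_le_rpow (μ := (volume : Measure (Rd d))) hd
    (f := fun y : Rd d => P.kernel y * ‖y‖ ^ 2) (C := 1) (α := (d : ℝ) + 2 * P.α - 2)
    (r := P.δ + 1) (by simp; linarith) (Eventually.of_forall fun y => by
      rcases eq_or_ne y 0 with rfl | hy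
      · simp only [norm_zero]
        simp
        positivity
      have hy' : 0 < ‖y‖ := norm_pos_iff.2 hy
      rw [Real.norm_of_nonneg (mul_nonneg (P.kernel_nonneg y) (by positivity)), neg_sub,
        Real.rpow_sub hy', kernel]
      rw [show ‖y‖ ^ (2 : ℝ) = ‖y‖ ^ 2 by norm_cast, one_mul, div_mul_eq_mul_div]
      gcongr
      exact mul_le_of_le_one_left (by positivity) (P.χ_le_one _)) hm
  refine (integrableOn_iff_integrable_of_support_subset fun y hy => ?_).1 h
  by_contra hy'
  apply hy
  have : P.δ < ‖y‖ := by
    simp at hy'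
    linarith
  simp [P.kernel_eq_zero this]

section SecondDifference


lemma test_lipschitz {G : Type} [NormedAddCommGroup G] [NormedSpace ℝ G]
    {V : Type} [NormedAddCommGroup V] [NormedSpace ℝ V] {g : V → G} (hg : ContDiff ℝ ∞ g)
    (hc : HasCompactSupport g) :
    ∃ C : ℝ, 0 ≤ C ∧ ∀ a b, ‖g a - g b‖ ≤ C * ‖a - b‖ := by
  obtain ⟨C, hC⟩ := ContDiff.lipschitzWith_of_hasCompactSupport hc hg (by simp)
  exact ⟨C, C.2, fun a b => hC.norm_sub_le a b⟩

lemma test_taylor {G : Type} [NormedAddCommGroup G] [NormedSpace ℝ G]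
    {V : Type} [NormedAddCommGroup V] [NormedSpace ℝ V] {g : V → G} (hg : ContDiff ℝ ∞ g)
    (hc : HasCompactSupport g) :
    ∃ C : ℝ, ∀ p h, ‖g (p + h) - g p - fderiv ℝ g p h‖ ≤ C * ‖h‖ ^ 2 := by
  have hg1 : ContDiff ℝ ∞ (fderiv ℝ g) := hg.fderiv_right (by simp)
  obtain ⟨C, hC0, hlip⟩ := test_lipschitz hg1 (hc.fderiv ℝ)
  have hd1 : Differentiable ℝ g := hg.differentiable (by simp)
  refine ⟨C, fun p h => ?_⟩
  have := (convex_closedBall p ‖h‖).norm_image_sub_le_of_norm_fderiv_le' (𝕜 := ℝ) (f := g)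
      (φ := fderiv ℝ g p) (C := C * ‖h‖) (x := p) (y := p + h) (fun x _ => hd1 x)
      (fun x hx => (hlip x p).trans (by
        have : ‖x - p‖ ≤ ‖h‖ := by simpa [dist_eq_norm] using hx
        gcongr)) (by simp) (by simp)
  rw [add_sub_cancel_left] at this
  exact this.trans (le_of_eq (by ring))

/-- The spatial second difference of a function of `(t, x)`. -/
def secondDiff {G : Type} [NormedAddCommGroup G] (g : ℝ × Rd d → G) (p : ℝ × Rd d) (y : Rd d) : G :=
  (g p - g (p + (0, y))) + (g p - g (p - (0, y)))

lemma secondDiff_bound {G : Type} [NormedAddCommGroup G] [NormedSpace ℝ G]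
    {g : ℝ × Rd d → G} (hg : ContDiff ℝ ∞ g)
    (hc : HasCompactSupport g) :
    ∃ C : ℝ, ∀ p y, ‖secondDiff g p y‖ ≤ C * ‖y‖ ^ 2 := by
  obtain ⟨C, key⟩ := test_taylor hg hc
  refine ⟨2 * C, fun p y => ?_⟩
  have h1 := key p (0, y)
  have h2 := key p (-(0, y))
  have hn : ‖((0 : ℝ), y)‖ = ‖y‖ := by simp [Prod.norm_def]
  rw [norm_neg, hn] at h2
  rw [hn] at h1
  have e : secondDiff g p y = -((g (p + (0, y)) - g p - fderiv ℝ g p (0, y)) +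
      (g (p + -(0, y)) - g p - fderiv ℝ g p (-(0, y)))) := by
    rw [ContinuousLinearMap.map_neg, ← sub_eq_add_neg p, secondDiff]
    abel
  rw [e, norm_neg]
  exact (norm_add_le _ _).trans (by linarith)

/-- The regularised form of the operator: twice the principal value integral. -/
def secondInt {G : Type} [NormedAddCommGroup G] [NormedSpace ℝ G]
    (g : ℝ × Rd d → G) (p : ℝ × Rd d) : G :=
  ∫ y : Rd d, P.kernel y • secondDiff g p y

lemma secondDiff_continuous {G : Type} [NormedAddCommGroup G] {g : ℝ × Rd d → G}
    (hg : Continuous g) (p : ℝ × Rd d) :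
    Continuous (secondDiff g p) := by
  unfold secondDiff
  fun_prop

lemma secondDiff_meas {G : Type} [NormedAddCommGroup G] [NormedSpace ℝ G]
    {g : ℝ × Rd d → G} (hg : Continuous g) (p : ℝ × Rd d) :
    AEStronglyMeasurable (fun y => P.kernel y • secondDiff g p y) (volume : Measure (Rd d)) :=
  P.kernel_measurable.aestronglyMeasurable.smul
    (secondDiff_continuous hg p).aestronglyMeasurable

lemma kernel_smul_le {G : Type} [NormedAddCommGroup G] [NormedSpace ℝ G]
    {C : ℝ} {y : Rd d} {z : G} (h : ‖z‖ ≤ C * ‖y‖ ^ 2) :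
    ‖P.kernel y • z‖ ≤ C * (P.kernel y * ‖y‖ ^ 2) := by
  rw [norm_smul, Real.norm_of_nonneg (P.kernel_nonneg y)]
  calc _ ≤ P.kernel y * (C * ‖y‖ ^ 2) := mul_le_mul_of_nonneg_left h (P.kernel_nonneg y)
    _ = _ := by ring

lemma secondDiff_integrable {G : Type} [NormedAddCommGroup G] [NormedSpace ℝ G]
    [NeZero d] {g : ℝ × Rd d → G} (hg : ContDiff ℝ ∞ g)
    (hc : HasCompactSupport g) (p : ℝ × Rd d) :
    Integrable (fun y : Rd d => P.kernel y • secondDiff g p y) := by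
  obtain ⟨C, hC⟩ := secondDiff_bound hg hc
  exact (P.kernel_mul_sq_integrable.const_mul C).mono' (P.secondDiff_meas hg.continuous p)
    (Eventually.of_forall fun y => P.kernel_smul_le (hC p y))

lemma secondInt_hasFDerivAt {G : Type} [NormedAddCommGroup G] [NormedSpace ℝ G]
    [NeZero d] {g : ℝ × Rd d → G} (hg : ContDiff ℝ ∞ g)
    (hc : HasCompactSupport g) (p : ℝ × Rd d) :
    HasFDerivAt (P.secondInt g) (P.secondInt (fderiv ℝ g) p) p := by
  have hg1 : ContDiff ℝ ∞ (fderiv ℝ g) := hg.fderiv_right (by simp)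
  have hd : Differentiable ℝ g := hg.differentiable (by simp)
  obtain ⟨C, hC⟩ := secondDiff_bound hg1 (hc.fderiv ℝ)
  refine hasFDerivAt_integral_of_dominated_of_fderiv_le (s := univ) univ_mem
    (Eventually.of_forall fun q => P.secondDiff_meas hg.continuous q)
    (P.secondDiff_integrable hg hc p) (P.secondDiff_meas hg1.continuous p)
    (Eventually.of_forall fun y q _ => P.kernel_smul_le (hC q y))
    (P.kernel_mul_sq_integrable.const_mul C) (Eventually.of_forall fun y q _ => ?_)
  refine HasFDerivAt.const_smul ?_ _
  have h0 := (hd q).hasFDerivAt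
  have h1 := (hd (q + (0, y))).hasFDerivAt.comp q ((hasFDerivAt_id q).add_const (0, y))
  have h2 := (hd (q - (0, y))).hasFDerivAt.comp q ((hasFDerivAt_id q).sub_const (0, y))
  exact (h0.sub h1).add (h0.sub h2)

lemma secondInt_contDiff_nat [NeZero d] (n : ℕ) :
    ∀ {G : Type} [NormedAddCommGroup G] [NormedSpace ℝ G] {g : ℝ × Rd d → G},
      ContDiff ℝ ∞ g → HasCompactSupport g → ContDiff ℝ n (P.secondInt g) := by
  induction n with
  | zero =>
    intro G _ _ g hg hc
    exact contDiff_zero.2 (continuous_iff_continuousAt.2 fun p =>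
      (P.secondInt_hasFDerivAt hg hc p).continuousAt)
  | succ n ih =>
    intro G _ _ g hg hc
    push_cast
    rw [contDiff_succ_iff_hasFDerivAt]
    exact ⟨_, ih (hg.fderiv_right (by simp)) (hc.fderiv ℝ),
      P.secondInt_hasFDerivAt hg hc⟩

lemma secondInt_contDiff {G : Type} [NormedAddCommGroup G] [NormedSpace ℝ G]
    [NeZero d] {g : ℝ × Rd d → G} (hg : ContDiff ℝ ∞ g)
    (hc : HasCompactSupport g) : ContDiff ℝ ∞ (P.secondInt g) :=
  contDiff_infty.2 fun n => P.secondInt_contDiff_nat n hg hc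

lemma secondInt_hasCompactSupport {G : Type} [NormedAddCommGroup G] [NormedSpace ℝ G]
    {g : ℝ × Rd d → G} (hc : HasCompactSupport g) :
    HasCompactSupport (P.secondInt g) := by
  have hK : IsCompact (tsupport g + ({(0 : ℝ)} ×ˢ Metric.closedBall (0 : Rd d) P.δ)) :=
    hc.isCompact.add (isCompact_singleton.prod (isCompact_closedBall _ _))
  refine HasCompactSupport.intro hK fun p hp => ?_
  have hz : ∀ y : Rd d, ‖y‖ ≤ P.δ → g (p + (0, y)) = 0 := by
    intro y hy
    by_contra hne
    apply hp
    refine ⟨p + (0, y), subset_tsupport _ hne, (0, -y), ?_, ?_⟩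
    · simpa using hy
    · ext <;> simp
  have h0 : g p = 0 := by
    have e0 : p + (0, (0 : Rd d)) = p := by ext <;> simp
    have h := hz 0 (by simpa using P.δ_pos.le)
    rwa [e0] at h
  have : ∀ y : Rd d, P.kernel y • secondDiff g p y = 0 := by
    intro y
    by_cases hy : ‖y‖ ≤ P.δ
    · have h1 := hz y hy
      have h2 := hz (-y) (by simpa using hy)
      have e : p - (0, y) = p + (0, -y) := by ext <;> simp [sub_eq_add_neg]
      simp [secondDiff, h0, h1, e, h2]
    · simp [P.kernel_eq_zero (not_le.1 hy)]
  simp [secondInt, this]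

end SecondDifference

lemma pv_eq_half_second [NeZero d] (φ : SpaceTimeTest d) (p : ℝ × Rd d) {ε : ℝ} (hε : 0 < ε) :
    ∫ y in (Metric.ball (0 : Rd d) ε)ᶜ, P.kernel y • (φ p - φ (p + (0, y))) =
      (1 / 2 : ℝ) • ∫ y in (Metric.ball (0 : Rd d) ε)ᶜ, P.kernel y • secondDiff φ p y := by
  set S : Set (Rd d) := (Metric.ball (0 : Rd d) ε)ᶜ with hS
  have hSm : MeasurableSet S := Metric.isOpen_ball.measurableSet.compl
  obtain ⟨M, hM⟩ := φ.continuous.bounded_above_of_compact_support φ.hasCompactSupport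
  have hM0 : 0 ≤ M := (norm_nonneg _).trans (hM 0)
  have hint : ∀ f : Rd d → Rd d, Continuous f → (∀ y, ‖f y‖ ≤ 2 * M) →
      IntegrableOn (fun y => P.kernel y • f y) S := by
    intro f hf hb
    refine ((P.kernel_mul_sq_integrable (d := d)).const_mul (2 * M / ε ^ 2)).integrableOn.mono'
      (P.kernel_measurable.aestronglyMeasurable.smul hf.aestronglyMeasurable)
      ((ae_restrict_iff' hSm).2 (Eventually.of_forall fun y hy => P.kernel_smul_le ?_))
    have hy' : ε ≤ ‖y‖ := by simpa [hS] using hy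
    calc ‖f y‖ ≤ 2 * M := hb y
      _ = 2 * M / ε ^ 2 * ε ^ 2 := by field_simp
      _ ≤ _ := by gcongr
  have hcont := φ.continuous
  have hb1 : ∀ q, ‖φ p - φ q‖ ≤ 2 * M := fun q =>
    (norm_sub_le _ _).trans (by linarith [hM p, hM q])
  have i1 := hint (fun y => φ p - φ (p + (0, y))) (by fun_prop) fun y => hb1 _
  have i2 := hint (fun y => φ p - φ (p - (0, y))) (by fun_prop) fun y => hb1 _
  have hneg : ∫ y in S, P.kernel y • (φ p - φ (p - (0, y))) =
      ∫ y in S, P.kernel y • (φ p - φ (p + (0, y))) := by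
    rw [← integral_indicator hSm, ← integral_indicator hSm, ← integral_neg_eq_self]
    congr 1
    ext1 y
    have hmem : -y ∈ S ↔ y ∈ S := by simp [hS]
    have e : p - (0, -y) = p + (0, y) := by ext <;> simp
    by_cases hy : y ∈ S
    · rw [indicator_of_mem (hmem.2 hy), indicator_of_mem hy, P.kernel_neg, e]
    · rw [indicator_of_notMem (fun h => hy (hmem.1 h)), indicator_of_notMem hy]
  have hsum : ∫ y in S, P.kernel y • secondDiff φ p y =
      (∫ y in S, P.kernel y • (φ p - φ (p + (0, y)))) +
        ∫ y in S, P.kernel y • (φ p - φ (p - (0, y))) := by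
    rw [← integral_add i1 i2]
    simp only [secondDiff, smul_add]
  rw [hsum, hneg, ← two_smul ℝ, smul_smul]
  norm_num

/-- The principal value converges, to the integral of the weighted second difference. -/
lemma pv_tendsto [NeZero d] (φ : SpaceTimeTest d) (p : ℝ × Rd d) :
    Tendsto (fun ε : ℝ => ∫ y in (Metric.ball (0 : Rd d) ε)ᶜ,
      P.kernel y • (φ p - φ (p + (0, y)))) (𝓝[>] 0) (𝓝 ((1 / 2 : ℝ) • P.secondInt φ p)) := by
  have hint := P.secondDiff_integrable φ.contDiff φ.hasCompactSupport p
  have h : Tendsto (fun ε : ℝ => ∫ y, (Metric.ball (0 : Rd d) ε)ᶜ.indicator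
      (fun y => P.kernel y • secondDiff φ p y) y) (𝓝[>] 0) (𝓝 (P.secondInt φ p)) := by
    refine tendsto_integral_filter_of_dominated_convergence
      (fun y => ‖P.kernel y • secondDiff φ p y‖)
      (Eventually.of_forall fun ε => hint.aestronglyMeasurable.indicator
        Metric.isOpen_ball.measurableSet.compl)
      (Eventually.of_forall fun ε => Eventually.of_forall fun y => norm_indicator_le_norm_self _ _)
      hint.norm (Eventually.of_forall fun y => ?_)
    rcases eq_or_ne y 0 with rfl | hy
    · have e : P.kernel (0 : Rd d) • secondDiff φ p 0 = 0 := by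
        have e0 : ((0 : ℝ), (0 : Rd d)) = 0 := rfl
        simp [secondDiff, e0]
      have : ∀ s : Set (Rd d), s.indicator (fun y => P.kernel y • secondDiff φ p y) 0 = 0 := by
        intro s
        by_cases h0 : (0 : Rd d) ∈ s
        · rw [indicator_of_mem h0, e]
        · rw [indicator_of_notMem h0]
      rw [e]
      simp only [this]
      exact tendsto_const_nhds
    · have hy' : 0 < ‖y‖ := norm_pos_iff.2 hy
      refine tendsto_const_nhds.congr' ?_
      filter_upwards [Ioo_mem_nhdsGT hy'] with ε hε
      rw [indicator_of_mem]
      simpa using hε.2.le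
  refine (h.const_smul (1 / 2 : ℝ)).congr' ?_
  filter_upwards [self_mem_nhdsWithin] with ε hε
  rw [P.pv_eq_half_second φ p hε, integral_indicator Metric.isOpen_ball.measurableSet.compl]

lemma adjointOp_eq [NeZero d] (φ : SpaceTimeTest d) (p : ℝ × Rd d) :
    P.adjointOp (fun x => φ (p.1, x)) p.2 =
      -((P.κ / P.δ ^ (2 * (1 - P.α))) • (1 / 2 : ℝ) • P.secondInt φ p) := by
  have h := (P.pv_tendsto φ p).limUnder_eq
  have e : ∀ y : Rd d, p + (0, y) = (p.1, p.2 + y) := fun y => by ext <;> simp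
  simp only [e] at h
  rw [adjointOp, h]

/-- The test function `(t, x) ↦ K_δ^*[φ(t, ·)](x)`. -/
def adjointTest [NeZero d] (φ : SpaceTimeTest d) : SpaceTimeTest d where
  toFun p := P.adjointOp (fun x => φ (p.1, x)) p.2
  contDiff' := by
    simp only [P.adjointOp_eq]
    exact ((P.secondInt_contDiff φ.contDiff φ.hasCompactSupport).const_smul _).const_smul _ |>.neg
  hasCompactSupport' := by
    simp only [P.adjointOp_eq]
    refine (P.secondInt_hasCompactSupport φ.hasCompactSupport).comp_left
      (g := fun z => -((P.κ / P.δ ^ (2 * (1 - P.α))) • (1 / 2 : ℝ) • z)) (by simp)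
  tsupport_subset' := subset_univ _

end PeridynamicsModel

/-! ### Distributional solutions -/

/-- The space `𝒟'(ℝ × ℝ^d; ℝ^d)`, the topological dual of `𝒟(ℝ × ℝ^d; ℝ^d)`. -/
abbrev SpaceTimeDistribution (d : ℕ) : Type := SpaceTimeTest d →L[ℝ] ℝ

/-- The space `𝒟'(ℝ^d; ℝ^d)`, the topological dual of `𝒟(ℝ^d; ℝ^d)`. -/
abbrev SpaceDistribution (d : ℕ) : Type := SpaceTest d →L[ℝ] ℝ

/-- Time slices of space-time test functions are compactly supported. -/
lemma slice_hasCompactSupport {d : ℕ} (φ : SpaceTimeTest d) (t : ℝ) :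
    HasCompactSupport fun x : Rd d => φ (t, x) := by
  refine HasCompactSupport.intro (φ.hasCompactSupport.isCompact.image continuous_snd)
    fun x hx => ?_
  by_contra hne
  exact hx ⟨(t, x), subset_tsupport _ hne, rfl⟩

/-- Time slices of space-time test functions are smooth. -/
lemma slice_contDiff {d : ℕ} (φ : SpaceTimeTest d) (t : ℝ) :
    ContDiff ℝ ∞ fun x : Rd d => φ (t, x) :=
  φ.contDiff.comp (contDiff_prodMk_right t)

/-- The time slice `φ(t, ·) ∈ 𝒟(ℝ^d; ℝ^d)` of `φ ∈ 𝒟(ℝ × ℝ^d; ℝ^d)`. -/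
def sliceTest {d : ℕ} (φ : SpaceTimeTest d) (t : ℝ) : SpaceTest d where
  toFun x := φ (t, x)
  contDiff' := slice_contDiff φ t
  hasCompactSupport' := slice_hasCompactSupport φ t
  tsupport_subset' := subset_univ _

/-- The time derivative `∂_t φ` of a space-time test function. -/
def timeDeriv {d : ℕ} (φ : SpaceTimeTest d) : SpaceTimeTest d :=
  ∂_{((1 : ℝ), (0 : Rd d))} φ

/-- `u` is a distributional solution of `∂_tt u - K_δ[u] = 0` with initial data `(u₀, v₀)`:
it is supported in `[0, ∞) × ℝ^d`, and
`⟨u, ∂_tt φ - K_δ^*[φ]⟩ = - ⟨u₀, ∂_t φ(0, ·)⟩ + ⟨v₀, φ(0, ·)⟩` for every test function `φ`. -/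
structure IsDistributionalSolution (P : PeridynamicsModel) {d : ℕ} [NeZero d]
    (u₀ v₀ : SpaceDistribution d) (u : SpaceTimeDistribution d) : Prop where
  support_subset : Distribution.dsupport u ⊆ Ici (0 : ℝ) ×ˢ (univ : Set (Rd d))
  weak_eq : ∀ φ : SpaceTimeTest d,
    u (timeDeriv (timeDeriv φ) - P.adjointTest φ) =
      -u₀ (sliceTest (timeDeriv φ) 0) + v₀ (sliceTest φ 0)

/-! ### The Sobolev spaces `H^s(ℝ^d; ℝ^d)` -/

/-- Tempered distributions with values in `ℂ^d`. -/
abbrev VectorTempered (d : ℕ) : Type := 𝓢'(Rd d, EuclideanSpace ℂ (Fin d))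

/-- A tempered distribution is real-valued if it takes values in `ℝ^d` on real-valued Schwartz
functions. -/
def IsRealValued {d : ℕ} (u : VectorTempered d) : Prop :=
  ∀ ψ : 𝓢(Rd d, ℂ), (∀ x, (ψ x).im = 0) → ∀ i, (u ψ i).im = 0

/-- The real-valued tempered distributions `u` with `(1 + |ξ|^2)^(s/2) û ∈ L^2`, as a real vector
space. -/
def sobolevSubmodule (d : ℕ) (s : ℝ) : Submodule ℝ (VectorTempered d) where
  carrier := {u | TemperedDistribution.MemSobolev s 2 u ∧ IsRealValued u}
  add_mem' {u v} hu hv := ⟨hu.1.add hv.1, fun ψ hψ i => by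
    change (u ψ i + v ψ i).im = 0
    simp [hu.2 ψ hψ i, hv.2 ψ hψ i]⟩
  zero_mem' := ⟨TemperedDistribution.memSobolev_fun_zero _ _ s 2, fun ψ _ i => by
    change (0 : ℂ).im = 0
    simp⟩
  smul_mem' c u hu := ⟨by
    have h := hu.1.smul (c : ℂ)
    have e : (c : ℂ) • u = c • u := by
      ext ψ i
      change (c : ℂ) • (u ψ i) = c • (u ψ i)
      simp
    rwa [e] at h, fun ψ hψ i => by
    change (c • u ψ i).im = 0
    simp [hu.2 ψ hψ i]⟩

/-- The Sobolev space `H^s(ℝ^d; ℝ^d)`. -/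
def SobolevH (d : ℕ) (s : ℝ) : Type := sobolevSubmodule d s

namespace SobolevH

variable {d : ℕ} {s : ℝ}

instance : AddCommGroup (SobolevH d s) := inferInstanceAs (AddCommGroup (sobolevSubmodule d s))

instance : Module ℝ (SobolevH d s) := inferInstanceAs (Module ℝ (sobolevSubmodule d s))

/-- The tempered distribution underlying an element of `H^s`. -/
def toTempered : SobolevH d s →ₗ[ℝ] VectorTempered d := (sobolevSubmodule d s).subtype

lemma lp_toTempered_injective {f g : Lp (EuclideanSpace ℂ (Fin d)) 2 (volume : Measure (Rd d))}
    (h : (f : VectorTempered d) = g) : f = g := by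
  have := LinearMap.ker_eq_bot.1 (Lp.ker_toTemperedDistributionCLM_eq_bot
    (E := Rd d) (F := EuclideanSpace ℂ (Fin d)) (μ := volume) (p := 2))
  exact this h

/-- The `L^2` function representing `(1 + |D|^2)^(s/2) u`. -/
def toL2 (u : SobolevH d s) : Lp (EuclideanSpace ℂ (Fin d)) 2 (volume : Measure (Rd d)) :=
  Classical.choose u.2.1

lemma toL2_spec (u : SobolevH d s) :
    TemperedDistribution.besselPotential _ _ s (toTempered u) = (toL2 u : VectorTempered d) :=
  Classical.choose_spec u.2.1

/-- The map `u ↦ (1 + |D|^2)^(s/2) u` from `H^s` to `L^2`, as an additive map. -/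
def toL2Hom : SobolevH d s →+ Lp (EuclideanSpace ℂ (Fin d)) 2 (volume : Measure (Rd d)) :=
  AddMonoidHom.mk' toL2 fun u v => by
    apply lp_toTempered_injective
    rw [← toL2_spec, map_add, map_add, toL2_spec, toL2_spec]
    simp only [← Lp.toTemperedDistributionCLM_apply, map_add]

lemma toL2Hom_injective : Function.Injective (toL2Hom : SobolevH d s →+ _) := by
  intro u v h
  have h' : toL2 u = toL2 v := h
  have h1 := toL2_spec u
  rw [h', ← toL2_spec v, ← sub_eq_zero, ← map_sub] at h1
  have h2 := congrArg (TemperedDistribution.besselPotential _ _ (-s)) h1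
  rw [TemperedDistribution.besselPotential_besselPotential_apply, map_zero] at h2
  simp only [add_neg_cancel, TemperedDistribution.besselPotential_zero,
    ContinuousLinearMap.id_apply, sub_eq_zero] at h2
  exact Subtype.ext h2

/-- The norm of `H^s` is `‖u‖ = ‖(1 + |ξ|^2)^(s/2) û‖_{L^2}`. -/
instance : NormedAddCommGroup (SobolevH d s) :=
  NormedAddCommGroup.induced _ _ toL2Hom toL2Hom_injective

end SobolevH

/-- The `i`-th component of `φ(t, ·)`, as a complex-valued Schwartz function. -/
def sliceSchwartz {d : ℕ} (φ : SpaceTimeTest d) (t : ℝ) (i : Fin d) : 𝓢(Rd d, ℂ) :=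
  HasCompactSupport.toSchwartzMap (f := fun x => ((φ (t, x) i : ℝ) : ℂ))
    ((slice_hasCompactSupport φ t).comp_left (g := fun z : Rd d => ((z i : ℝ) : ℂ)) (by simp))
    (Complex.ofRealCLM.contDiff.comp ((EuclideanSpace.proj (𝕜 := ℝ) i).contDiff.comp
      (slice_contDiff φ t)))

/-- The (real) duality pairing `⟨w, φ(t, ·)⟩ = ∑ i, ⟨w_i, φ_i(t, ·)⟩` of `w ∈ H^s(ℝ^d; ℝ^d)` with a
time slice of a test function. -/
def slicePairing {d : ℕ} {s : ℝ} (w : SobolevH d s) (φ : SpaceTimeTest d) (t : ℝ) : ℝ :=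
  ∑ i, (w.toTempered (sliceSchwartz φ t i) i).re

/-- The distribution `u` is the function `U : (0, ∞) → H^s`, regarded as a distribution through
the absolutely convergent integrals `⟨u, φ⟩ = ∫_{(0, ∞)} ⟨U(t), φ(t, ·)⟩ dt`. -/
def IsRepresentedBy {d : ℕ} {s : ℝ} (u : SpaceTimeDistribution d) (U : ℝ → SobolevH d s) : Prop :=
  ∀ φ : SpaceTimeTest d,
    IntegrableOn (fun t => slicePairing (U t) φ t) (Ioi 0) ∧
      u φ = ∫ t in Ioi (0 : ℝ), slicePairing (U t) φ t

end

/-! On the Fourier side the peridynamics operator is multiplication by a real symbol m ≤ 0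
(`fourierInv_scalarOp`), so the weighted transform g(t) = (1 + |ξ|²)^(s/2) Û(t) ∈ L² is a weak
solution in time of g'' = m g. Since |m(ξ)| ≤ C|ξ|², restriction to a ball |ξ| < R replaces m by a
bounded symmetric nonpositive operator M. The estimates below do not depend on R, so R → ∞ costs
nothing.

The core is one inequality. If y'' = M y, then formally y(t + h) + y(t - h) = 2 cos(h √(-M)) y(t),
so this sum has norm at most 2‖y(t)‖. `norm_symmetric_sum_le_of_hasDerivAt` obtains this from an
energy identity, and `ae_norm_symmetric_sum_le` carries it to locally integrable weak solutions by
mollification.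

It is used twice. First, U is locally integrable only on the open half-line; centre t + 1 and step 1
give ‖g(t)‖ ≤ 2‖g(t + 1)‖ + ‖g(t + 2)‖, which is integrable down to t = 0. Hence the extension of g
by zero to negative times is locally integrable, and since the initial data vanish it solves the
equation on all of ℝ. Second, for 0 < t < n take centre t - n and step n: both t - n and t - 2n are
negative, so ‖g(t)‖ ≤ 0.

Reaching the equation in L² from pairings with test functions is the role of `ae_eq_symbol_smul`:
translating a test function produces every character, so Fourier uniqueness applies. -/

noncomputable section

/-! ### Abstract wave equations with a bounded nonpositive operator -/

section AbstractWave

open scoped Convolution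

variable {𝕜 H : Type*} [RCLike 𝕜] [NormedAddCommGroup H] [InnerProductSpace 𝕜 H] [NormedSpace ℝ H]

lemma eq_of_hasDerivAt_zero_on_Icc {E : Type*} [NormedAddCommGroup E] [NormedSpace ℝ E]
    {f : ℝ → E} {h : ℝ} (hh : 0 ≤ h) (hf : ∀ r ∈ Icc 0 h, HasDerivAt f 0 r) : f h = f 0 :=
  constant_of_has_deriv_right_zero (fun r hr => (hf r hr).continuousAt.continuousWithinAt)
    (fun r hr => (hf r (Ico_subset_Icc_self hr)).hasDerivWithinAt) h (right_mem_Icc.2 hh)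

/-- For a solution of `y'' = M y` with `M` symmetric and nonpositive, the symmetric sum
`y (t + h) + y (t - h)` is bounded by `2 ‖y t‖`. -/
lemma norm_symmetric_sum_le_of_hasDerivAt {M : H →L[ℝ] H}
    (hsym : ∀ x z, inner 𝕜 (M x) z = inner 𝕜 x (M z))
    (hneg : ∀ x, RCLike.re (inner 𝕜 (M x) x) ≤ 0) {a : ℝ} {Y y y' : ℝ → H}
    (hY : ∀ t, a < t → HasDerivAt Y (y t) t) (hy : ∀ t, a < t → HasDerivAt y (y' t) t)
    (hy' : ∀ t, a < t → HasDerivAt y' (M (y t)) t) {t h : ℝ} (hh : 0 ≤ h) (hth : a < t - h) :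
    ‖y (t + h) + y (t - h)‖ ≤ 2 * ‖y t‖ := by
  have shift : ∀ {z z' : ℝ → H}, (∀ t, a < t → HasDerivAt z (z' t) t) → ∀ r ∈ Icc 0 h,
      HasDerivAt (fun r => z (t + r)) (z' (t + r)) r ∧
        HasDerivAt (fun r => z (t - r)) (-z' (t - r)) r := by
    intro z z' hz r hr
    exact ⟨(hz (t + r) (by linarith [hr.1])).comp_const_add t r,
      (hz (t - r) (by linarith [hr.2])).comp_const_sub t r⟩
  -- Write W(r) = Y(t + r) - Y(t - r) and w = W'. The primitive Y serves to make W vanish at r = 0.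
  have hW : ∀ r ∈ Icc 0 h, HasDerivAt (fun r => Y (t + r) - Y (t - r)) (y (t + r) + y (t - r)) r :=
    fun r hr => ((shift hY r hr).1.sub (shift hY r hr).2).congr_deriv (by abel)
  have hw : ∀ r ∈ Icc 0 h,
      HasDerivAt (fun r => y (t + r) + y (t - r)) (y' (t + r) - y' (t - r)) r :=
    fun r hr => ((shift hy r hr).1.add (shift hy r hr).2).congr_deriv (by abel)
  -- The equation integrated once: w' and M W both vanish at r = 0 and both have derivative M w.
  -- This gives the first-order system W' = w, w' = M W.
  have hD : ∀ r ∈ Icc 0 h, y' (t + r) - y' (t - r) = M (Y (t + r) - Y (t - r)) := by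
    intro r hr
    have key := eq_of_hasDerivAt_zero_on_Icc
      (f := fun r => y' (t + r) - y' (t - r) - M (Y (t + r) - Y (t - r))) hr.1 fun q hq => by
        have hq' : q ∈ Icc 0 h := ⟨hq.1, hq.2.trans hr.2⟩
        have h1 := ((shift hy' q hq').1.sub (shift hy' q hq').2).sub
          (M.hasFDerivAt.comp_hasDerivAt q (hW q hq'))
        exact h1.congr_deriv (by rw [map_add]; abel)
    simpa [sub_eq_zero] using key
  -- Energy identity: ‖w‖² - Re⟨M W, W⟩ is constant by symmetry of M. At r = 0 it equals ‖2 y(t)‖²,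
  -- and -Re⟨M W, W⟩ ≥ 0 may be dropped at r = h.
  have hE := eq_of_hasDerivAt_zero_on_Icc (f := fun r =>
    RCLike.re (inner 𝕜 (y (t + r) + y (t - r)) (y (t + r) + y (t - r))) -
      RCLike.re (inner 𝕜 (M (Y (t + r) - Y (t - r))) (Y (t + r) - Y (t - r)))) hh fun r hr => by
    have h1 := (hw r hr).inner 𝕜 (hw r hr)
    have h2 := (M.hasFDerivAt.comp_hasDerivAt r (hW r hr)).inner 𝕜 (hW r hr)
    have h3 := ((RCLike.reCLM (K := 𝕜)).hasFDerivAt.comp_hasDerivAt r h1).sub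
      ((RCLike.reCLM (K := 𝕜)).hasFDerivAt.comp_hasDerivAt r h2)
    refine h3.congr_deriv ?_
    rw [hD r hr, hsym (y (t + r) + y (t - r))]
    simp only [Function.comp_apply]
    rw [add_comm, sub_self]
  simp only [add_zero, sub_zero, sub_self, map_zero, inner_zero_left, inner_self_eq_norm_sq]
    at hE
  have h4 : ‖y t + y t‖ ≤ 2 * ‖y t‖ := (norm_add_le _ _).trans (by linarith)
  refine le_trans ?_ h4
  refine le_of_sq_le_sq ?_ (norm_nonneg _)
  linarith [hneg (Y (t + h) - Y (t - h))]

/-- The almost everywhere version of `norm_symmetric_sum_le_of_hasDerivAt` for locally integrable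
weak solutions of `g'' = M g`. -/
lemma ae_norm_symmetric_sum_le [CompleteSpace H] {M : H →L[ℝ] H}
    (hsym : ∀ x z, inner 𝕜 (M x) z = inner 𝕜 x (M z))
    (hneg : ∀ x, RCLike.re (inner 𝕜 (M x) x) ≤ 0) {a : ℝ} {g : ℝ → H}
    (hg : LocallyIntegrable g volume)
    (hweak : ∀ θ : ℝ → ℝ, ContDiff ℝ ∞ θ → HasCompactSupport θ → tsupport θ ⊆ Ioi a →
      ∫ t, deriv (deriv θ) t • g t = M (∫ t, θ t • g t)) {h : ℝ} (hh : 0 ≤ h) :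
    ∀ᵐ t, a + h < t → ‖g (t + h) + g (t - h)‖ ≤ 2 * ‖g t‖ := by
  -- The ratio of outer to inner radius stays 2; a bounded ratio is what almost everywhere
  -- convergence of the mollifications requires.
  let φ : ℕ → ContDiffBump (0 : ℝ) := fun n =>
    { rIn := 1 / ((n : ℝ) + 1)
      rOut := 2 / ((n : ℝ) + 1)
      rIn_pos := by positivity
      rIn_lt_rOut := by gcongr; norm_num }
  have hφ : Tendsto (fun n => (φ n).rOut) atTop (𝓝 0) := by
    simpa [φ, div_eq_mul_inv] using (tendsto_one_div_add_atTop_nhds_zero_nat (𝕜 := ℝ)).const_mul 2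
  have hφK : ∀ᶠ n in atTop, (φ n).rOut ≤ 2 * (φ n).rIn :=
    Eventually.of_forall fun n => le_of_eq (by simp only [φ]; ring)
  have hlim := ContDiffBump.ae_convolution_tendsto_right_of_locallyIntegrable hφ hφK hg
  have hlim_add : ∀ᵐ t, Tendsto (fun n => ((φ n).normed volume
      ⋆[ContinuousLinearMap.lsmul ℝ ℝ, volume] g) (t + h)) atTop (𝓝 (g (t + h))) :=
    (measurePreserving_add_right volume h).quasiMeasurePreserving.ae hlim
  have hlim_sub : ∀ᵐ t, Tendsto (fun n => ((φ n).normed volume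
      ⋆[ContinuousLinearMap.lsmul ℝ ℝ, volume] g) (t - h)) atTop (𝓝 (g (t - h))) := by
    simpa only [sub_eq_add_neg] using
      (measurePreserving_add_right volume (-h)).quasiMeasurePreserving.ae hlim
  filter_upwards [hlim, hlim_add, hlim_sub] with t h0 h1 h2 hat
  refine le_of_tendsto_of_tendsto (h1.add h2).norm (h0.norm.const_mul 2) ?_
  filter_upwards [hφ.eventually_lt_const (sub_pos.2 hat)] with n hn
  set f : ℝ → ℝ := (φ n).normed volume with hf_def
  have hf : ContDiff ℝ ∞ f := (φ n).contDiff_normed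
  have hfc : HasCompactSupport f := (φ n).hasCompactSupport_normed
  have hf' : ContDiff ℝ ∞ (deriv f) := (contDiff_infty_iff_deriv.1 hf).2
  have hd0 := hfc.hasDerivAt_convolution_left (ContinuousLinearMap.lsmul ℝ ℝ)
    (hf.of_le (by simp)) hg
  have hd1 := hfc.deriv.hasDerivAt_convolution_left (ContinuousLinearMap.lsmul ℝ ℝ)
    (hf'.of_le (by simp)) hg
  have hcont : Continuous (f ⋆[ContinuousLinearMap.lsmul ℝ ℝ, volume] g) :=
    continuous_iff_continuousAt.2 fun x => (hd0 x).continuousAt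
  -- Mollifying costs one radius: the smooth equation holds only beyond a + rOut, which is
  -- eventually below t - h.
  refine norm_symmetric_sum_le_of_hasDerivAt (𝕜 := 𝕜) hsym hneg (a := a + (φ n).rOut)
    (Y := fun x => ∫ τ in (0 : ℝ)..x, (f ⋆[ContinuousLinearMap.lsmul ℝ ℝ, volume] g) τ)
    (fun x _ => intervalIntegral.integral_hasDerivAt_right (hcont.intervalIntegrable _ _)
      hcont.stronglyMeasurable.stronglyMeasurableAtFilter hcont.continuousAt)
    (fun x _ => hd0 x) (fun x hx => (hd1 x).congr_deriv ?_) hh (by linarith)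
  rw [convolution_eq_swap, convolution_eq_swap]
  have hθ' : deriv (fun σ => f (x - σ)) = fun σ => -deriv f (x - σ) := by
    ext σ
    rw [deriv_comp_const_sub]
  have hθ'' : deriv (deriv fun σ => f (x - σ)) = fun σ => deriv (deriv f) (x - σ) := by
    ext σ
    rw [hθ', deriv.fun_neg, deriv_comp_const_sub, neg_neg]
  have hsupp : tsupport (fun σ => f (x - σ)) ⊆ Metric.closedBall x (φ n).rOut := by
    refine closure_minimal (fun σ hσ => ?_) Metric.isClosed_closedBall
    have : x - σ ∈ Function.support f := hσ
    rw [hf_def, (φ n).support_normed_eq] at this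
    rw [Metric.mem_closedBall, dist_comm, Real.dist_eq]
    simpa using (Metric.mem_ball.1 this).le
  -- The reflected mollifier is itself an admissible test function, and the two signs from
  -- differentiating in σ cancel.
  have := hweak (fun σ => f (x - σ)) (hf.comp (contDiff_const.sub contDiff_id))
    ((isCompact_closedBall x (φ n).rOut).of_isClosed_subset (isClosed_tsupport _) hsupp) (fun σ hσ => by
      have := hsupp hσ
      rw [Metric.mem_closedBall, dist_comm, Real.dist_eq] at this
      have := (abs_le.1 this).2
      simp only [mem_Ioi]
      linarith)
  rw [hθ''] at this
  exact this

end AbstractWave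

/-! ### The Fourier symbol of the peridynamics operator -/

section Symbol

open scoped RealInnerProductSpace FourierTransform

/-- Smooth compactly supported real functions on space. -/
abbrev ScalarTest (d : ℕ) : Type := 𝓓((⊤ : TopologicalSpace.Opens (Rd d)), ℝ)

namespace ScalarTest

variable {d : ℕ}

/-- The symmetric second difference `2 ψ(x) - ψ(x + y) - ψ(x - y)`. -/
def symmDiff (ψ : ScalarTest d) (x y : Rd d) : ℝ :=
  (ψ x - ψ (x + y)) + (ψ x - ψ (x - y))

/-- A smooth cutoff on the time axis equal to one at the origin. -/
def timeCutoff : ContDiffBump (0 : ℝ) := ⟨1, 2, one_pos, one_lt_two⟩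

lemma timeCutoff_zero : timeCutoff (0 : ℝ) = 1 :=
  timeCutoff.one_of_mem_closedBall (Metric.mem_closedBall_self timeCutoff.rIn_pos.le)

/-- The extension of a spatial test function to a space-time test function. -/
def extend (ψ : ScalarTest d) (p : ℝ × Rd d) : ℝ := timeCutoff p.1 * ψ p.2

lemma extend_contDiff (ψ : ScalarTest d) : ContDiff ℝ ∞ ψ.extend :=
  (timeCutoff.contDiff.comp contDiff_fst).mul (ψ.contDiff.comp contDiff_snd)

lemma hasCompactSupport_mul_prod {θ : ℝ → ℝ} (hθ : HasCompactSupport θ) (ψ : ScalarTest d) :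
    HasCompactSupport fun p : ℝ × Rd d => θ p.1 * ψ p.2 := by
  refine HasCompactSupport.intro (hθ.isCompact.prod ψ.hasCompactSupport.isCompact) fun p hp => ?_
  by_contra hne
  exact hp ⟨subset_tsupport _ (left_ne_zero_of_mul hne), subset_tsupport _ (right_ne_zero_of_mul hne)⟩

lemma extend_hasCompactSupport (ψ : ScalarTest d) : HasCompactSupport ψ.extend :=
  hasCompactSupport_mul_prod timeCutoff.hasCompactSupport ψ

lemma secondDiff_extend (ψ : ScalarTest d) (x y : Rd d) :
    PeridynamicsModel.secondDiff ψ.extend (0, x) y = ψ.symmDiff x y := by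
  simp [PeridynamicsModel.secondDiff, extend, symmDiff, timeCutoff_zero]

lemma symmDiff_bound (ψ : ScalarTest d) : ∃ C : ℝ, ∀ x y, |ψ.symmDiff x y| ≤ C * ‖y‖ ^ 2 := by
  obtain ⟨C, hC⟩ := PeridynamicsModel.secondDiff_bound ψ.extend_contDiff ψ.extend_hasCompactSupport
  exact ⟨C, fun x y => by simpa [secondDiff_extend] using hC (0, x) y⟩

end ScalarTest

namespace PeridynamicsModel

variable (P : PeridynamicsModel) {d : ℕ}

/-- The prefactor `κ / δ^(2 (1 - α))`. -/
def coeff : ℝ := P.κ / P.δ ^ (2 * (1 - P.α))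

lemma coeff_pos : 0 < P.coeff :=
  div_pos P.κ_pos (Real.rpow_pos_of_pos P.δ_pos _)

/-- The peridynamics operator on scalar test functions. -/
def scalarOp [NeZero d] (ψ : ScalarTest d) : ScalarTest d where
  toFun x := -(P.coeff * ((1 / 2) * ∫ y, P.kernel y * ψ.symmDiff x y))
  contDiff' := by
    -- Smoothness is inherited from the space-time extension on the slice t = 0, where the time
    -- cutoff is 1.
    have h := (P.secondInt_contDiff ψ.extend_contDiff ψ.extend_hasCompactSupport).comp
      (contDiff_prodMk_right (0 : ℝ))
    simp only [Function.comp_def, secondInt, ScalarTest.secondDiff_extend, smul_eq_mul] at h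
    exact (contDiff_const.mul (contDiff_const.mul h)).neg
  hasCompactSupport' := by
    have h := P.secondInt_hasCompactSupport ψ.extend_hasCompactSupport
    refine HasCompactSupport.intro (h.isCompact.image continuous_snd) fun x hx => ?_
    have h0 : P.secondInt ψ.extend (0, x) = 0 := by
      by_contra hne
      exact hx ⟨(0, x), subset_tsupport _ hne, rfl⟩
    simp only [secondInt, ScalarTest.secondDiff_extend, smul_eq_mul] at h0
    simp [h0]
  tsupport_subset' := subset_univ _

lemma scalarOp_apply [NeZero d] (ψ : ScalarTest d) (x : Rd d) :
    P.scalarOp ψ x = -(P.coeff * ((1 / 2) * ∫ y, P.kernel y * ψ.symmDiff x y)) := rfl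

/-- The Fourier symbol of the peridynamics operator. -/
def symbol (ξ : Rd d) : ℝ :=
  -(P.coeff * ∫ y : Rd d, P.kernel y * (1 - Real.cos (2 * Real.pi * ⟪y, ξ⟫)))

lemma symbol_nonpos (ξ : Rd d) : P.symbol ξ ≤ 0 := by
  have : 0 ≤ ∫ y : Rd d, P.kernel y * (1 - Real.cos (2 * Real.pi * ⟪y, ξ⟫)) :=
    integral_nonneg fun y =>
      mul_nonneg (P.kernel_nonneg y) (sub_nonneg.2 (Real.cos_le_one _))
  have := mul_nonneg P.coeff_pos.le this
  simp only [symbol]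
  linarith

lemma one_sub_cos_inner_le (y ξ : Rd d) :
    1 - Real.cos (2 * Real.pi * ⟪y, ξ⟫) ≤ 2 * Real.pi ^ 2 * ‖ξ‖ ^ 2 * ‖y‖ ^ 2 := by
  have h1 := Real.one_sub_sq_div_two_le_cos (x := 2 * Real.pi * ⟪y, ξ⟫)
  have h2 : ⟪y, ξ⟫ ^ 2 ≤ ‖y‖ ^ 2 * ‖ξ‖ ^ 2 := by
    rw [← mul_pow]
    exact sq_le_sq.2 ((abs_real_inner_le_norm y ξ).trans (le_abs_self _))
  have h3 : 2 * Real.pi ^ 2 * ⟪y, ξ⟫ ^ 2 ≤ 2 * Real.pi ^ 2 * (‖y‖ ^ 2 * ‖ξ‖ ^ 2) := by gcongr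
  nlinarith

/-- The quadratic bound on 1 - cos compensates the singularity of the kernel. It makes the symbol
bounded on balls, hence the truncated operators bounded. -/
lemma abs_symbol_le [NeZero d] : ∃ C : ℝ, ∀ ξ : Rd d, |P.symbol ξ| ≤ C * ‖ξ‖ ^ 2 := by
  refine ⟨P.coeff * (2 * Real.pi ^ 2 * ∫ y : Rd d, P.kernel y * ‖y‖ ^ 2), fun ξ => ?_⟩
  rw [symbol, abs_neg, abs_mul, abs_of_pos P.coeff_pos, mul_assoc, mul_assoc]
  gcongr
  · exact P.coeff_pos.le
  have h := norm_integral_le_of_norm_le (((P.kernel_mul_sq_integrable (d := d)).const_mul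
    (2 * Real.pi ^ 2 * ‖ξ‖ ^ 2)))
    (f := fun y : Rd d => P.kernel y * (1 - Real.cos (2 * Real.pi * ⟪y, ξ⟫)))
    (Eventually.of_forall fun y => by
      have h0 : 0 ≤ 1 - Real.cos (2 * Real.pi * ⟪y, ξ⟫) := sub_nonneg.2 (Real.cos_le_one _)
      rw [Real.norm_of_nonneg (mul_nonneg (P.kernel_nonneg y) h0)]
      have := mul_le_mul_of_nonneg_left (one_sub_cos_inner_le y ξ) (P.kernel_nonneg y)
      linarith)
  rw [integral_const_mul] at h
  rw [Real.norm_eq_abs] at h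
  linarith

lemma symbol_measurable : Measurable (P.symbol : Rd d → ℝ) := by
  have hk := P.kernel_measurable (d := d)
  have : StronglyMeasurable (Function.uncurry fun (ξ y : Rd d) =>
      P.kernel y * (1 - Real.cos (2 * Real.pi * ⟪y, ξ⟫))) := by
    apply Measurable.stronglyMeasurable
    unfold Function.uncurry
    fun_prop
  exact (this.integral_prod_right.measurable.const_mul _).neg

end PeridynamicsModel

namespace ScalarTest

variable {d : ℕ}

/-- The complex-valued Schwartz function underlying a scalar test function. -/
def toSchwartz (ψ : ScalarTest d) : 𝓢(Rd d, ℂ) :=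
  HasCompactSupport.toSchwartzMap (f := fun x => ((ψ x : ℝ) : ℂ))
    (ψ.hasCompactSupport.comp_left (g := fun z : ℝ => (z : ℂ)) (by simp))
    (Complex.ofRealCLM.contDiff.comp ψ.contDiff)

lemma toSchwartz_apply (ψ : ScalarTest d) (x : Rd d) : ψ.toSchwartz x = (ψ x : ℂ) := rfl

lemma fourierInv_toSchwartz (ψ : ScalarTest d) (ξ : Rd d) :
    𝓕⁻ ψ.toSchwartz ξ = ∫ x, (Real.fourierChar ⟪x, ξ⟫ : ℂ) * (ψ x : ℂ) := by
  rw [SchwartzMap.fourierInv_coe, Real.fourierInv_eq]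
  rfl

lemma integrable_char_mul (ψ : ScalarTest d) (ξ : Rd d) :
    Integrable fun x => (Real.fourierChar ⟪x, ξ⟫ : ℂ) * (ψ x : ℂ) := by
  refine Continuous.integrable_of_hasCompactSupport (by fun_prop) ?_
  exact (ψ.hasCompactSupport.comp_left (g := fun z : ℝ => (z : ℂ)) (by simp)).mul_left

lemma integral_char_mul_comp_add (ψ : ScalarTest d) (ξ y : Rd d) :
    ∫ x, (Real.fourierChar ⟪x, ξ⟫ : ℂ) * (ψ (x + y) : ℂ) =
      (Real.fourierChar (-⟪y, ξ⟫) : ℂ) * 𝓕⁻ ψ.toSchwartz ξ := by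
  rw [fourierInv_toSchwartz, ← integral_const_mul,
    ← integral_add_right_eq_self (fun x => _ * (_ * (ψ x : ℂ))) y]
  congr 1 with x
  rw [← mul_assoc, ← Circle.coe_mul, ← AddChar.map_add_eq_mul, inner_add_left]
  congr 4
  ring

lemma integrable_char_mul_comp_add (ψ : ScalarTest d) (ξ y : Rd d) :
    Integrable fun x => (Real.fourierChar ⟪x, ξ⟫ : ℂ) * (ψ (x + y) : ℂ) := by
  refine (((ψ.integrable_char_mul ξ).comp_add_right y).const_mul
    (Real.fourierChar (-⟪y, ξ⟫) : ℂ)).congr (Eventually.of_forall fun x => ?_)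
  simp only
  rw [← mul_assoc, ← Circle.coe_mul, ← AddChar.map_add_eq_mul, inner_add_left]
  congr 4
  ring

/-- Each shift becomes a character, and the opposite shifts ±y combine into a cosine; this is why
the symbol is real. -/
lemma integral_char_mul_symmDiff (ψ : ScalarTest d) (ξ y : Rd d) :
    ∫ x, (Real.fourierChar ⟪x, ξ⟫ : ℂ) * (ψ.symmDiff x y : ℂ) =
      ((2 * (1 - Real.cos (2 * Real.pi * ⟪y, ξ⟫)) : ℝ) : ℂ) * 𝓕⁻ ψ.toSchwartz ξ := by
  have h0 := ψ.integrable_char_mul ξ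
  have h1 := ψ.integrable_char_mul_comp_add ξ y
  have h2 := ψ.integrable_char_mul_comp_add ξ (-y)
  have e : ∀ x, (Real.fourierChar ⟪x, ξ⟫ : ℂ) * (ψ.symmDiff x y : ℂ) =
      ((Real.fourierChar ⟪x, ξ⟫ : ℂ) * (ψ x : ℂ) -
        (Real.fourierChar ⟪x, ξ⟫ : ℂ) * (ψ (x + y) : ℂ)) +
      ((Real.fourierChar ⟪x, ξ⟫ : ℂ) * (ψ x : ℂ) -
        (Real.fourierChar ⟪x, ξ⟫ : ℂ) * (ψ (x + -y) : ℂ)) := by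
    intro x
    rw [symmDiff, sub_eq_add_neg x y]
    push_cast
    ring
  have hcos : (Real.fourierChar (-⟪y, ξ⟫) : ℂ) + (Real.fourierChar ⟪y, ξ⟫ : ℂ) =
      2 * (Real.cos (2 * Real.pi * ⟪y, ξ⟫) : ℂ) := by
    rw [Real.fourierChar_apply, Real.fourierChar_apply, Complex.ofReal_cos, Complex.cos]
    push_cast
    ring_nf
  simp only [e]
  refine (integral_add (h0.sub h1) (h0.sub h2)).trans ?_
  rw [integral_sub' h0 h1, integral_sub' h0 h2,
    integral_char_mul_comp_add, integral_char_mul_comp_add, ← fourierInv_toSchwartz,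
    inner_neg_left, neg_neg]
  push_cast at hcos ⊢
  linear_combination (-(𝓕⁻ ψ.toSchwartz ξ)) * hcos

lemma exists_symmDiff_eq_zero (ψ : ScalarTest d) (δ : ℝ) :
    ∃ r : ℝ, ∀ x y, ‖y‖ ≤ δ → r < ‖x‖ → ψ.symmDiff x y = 0 := by
  obtain ⟨r, hr⟩ := ψ.hasCompactSupport.isCompact.isBounded.exists_norm_le
  have hz : ∀ x, r < ‖x‖ → ψ x = 0 := fun x hx => by
    by_contra hne
    exact hx.not_ge (hr x (subset_tsupport _ hne))
  refine ⟨r + δ, fun x y hy hx => ?_⟩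
  have h1 : ‖x‖ ≤ ‖x + y‖ + ‖y‖ := by simpa using norm_sub_le (x + y) y
  have h2 : ‖x‖ ≤ ‖x - y‖ + ‖y‖ := by simpa using norm_add_le (x - y) y
  rw [symmDiff, hz x (by linarith [norm_nonneg y]), hz (x + y) (by linarith),
    hz (x - y) (by linarith)]
  simp

end ScalarTest

namespace PeridynamicsModel

variable (P : PeridynamicsModel) {d : ℕ}

/-- Integrability for Fubini: as the kernel lives in |y| ≤ δ, only x in a fixed ball matter, and the
integrand is dominated there by C times the integrable kernel(y)|y|². -/
lemma integrable_kernel_mul_symmDiff [NeZero d] (ψ : ScalarTest d) (ξ : Rd d) :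
    Integrable (Function.uncurry fun x y : Rd d =>
      (Real.fourierChar ⟪x, ξ⟫ : ℂ) * ((P.kernel y * ψ.symmDiff x y : ℝ) : ℂ))
      (volume.prod volume) := by
  obtain ⟨C, hC⟩ := ψ.symmDiff_bound
  obtain ⟨r, hr⟩ := ψ.exists_symmDiff_eq_zero P.δ
  have h1 : Integrable ((Metric.closedBall (0 : Rd d) r).indicator fun _ => C) :=
    (integrable_indicator_iff Metric.isClosed_closedBall.measurableSet).2
      (integrableOn_const (isCompact_closedBall _ _).measure_lt_top.ne)
  refine (h1.mul_prod (P.kernel_mul_sq_integrable (d := d))).mono' ?_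
    (Eventually.of_forall fun ⟨x, y⟩ => ?_)
  · have hk := P.kernel_measurable (d := d)
    have hψ : Measurable ψ := ψ.continuous.measurable
    have he : Measurable fun p : Rd d × Rd d => (Real.fourierChar ⟪p.1, ξ⟫ : ℂ) :=
      Continuous.measurable (by fun_prop)
    have h2 : Measurable fun p : Rd d × Rd d => P.kernel p.2 * ψ.symmDiff p.1 p.2 := by
      unfold ScalarTest.symmDiff
      fun_prop
    exact (he.mul (Complex.measurable_ofReal.comp h2)).aestronglyMeasurable
  · simp only [Function.uncurry_apply_pair, norm_mul, Circle.norm_coe, one_mul,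
      Complex.norm_real, Real.norm_eq_abs, abs_of_nonneg (P.kernel_nonneg y)]
    by_cases hy : ‖y‖ ≤ P.δ
    · by_cases hx : r < ‖x‖
      · rw [hr x y hy hx, indicator_of_notMem (by simpa using hx)]
        simp
      · rw [indicator_of_mem (by simpa using hx)]
        have := mul_le_mul_of_nonneg_left (hC x y) (P.kernel_nonneg y)
        linarith
    · simp [P.kernel_eq_zero (not_le.1 hy)]

/-- The peridynamics operator is the Fourier multiplier with symbol `symbol`. -/
lemma fourierInv_scalarOp [NeZero d] (ψ : ScalarTest d) (ξ : Rd d) :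
    𝓕⁻ (P.scalarOp ψ).toSchwartz ξ = (P.symbol ξ : ℂ) * 𝓕⁻ ψ.toSchwartz ξ := by
  have hpt : ∀ x, (Real.fourierChar ⟪x, ξ⟫ : ℂ) * (P.scalarOp ψ x : ℂ) =
      -(P.coeff / 2 : ℂ) * ∫ y, (Real.fourierChar ⟪x, ξ⟫ : ℂ) *
        ((P.kernel y * ψ.symmDiff x y : ℝ) : ℂ) := by
    intro x
    rw [integral_const_mul, integral_complex_ofReal, scalarOp_apply]
    push_cast
    ring
  have hy : ∀ y, ∫ x, (Real.fourierChar ⟪x, ξ⟫ : ℂ) * ((P.kernel y * ψ.symmDiff x y : ℝ) : ℂ) =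
      ((2 * (P.kernel y * (1 - Real.cos (2 * Real.pi * ⟪y, ξ⟫))) : ℝ) : ℂ) *
        𝓕⁻ ψ.toSchwartz ξ := by
    intro y
    have e : ∀ x, (Real.fourierChar ⟪x, ξ⟫ : ℂ) * ((P.kernel y * ψ.symmDiff x y : ℝ) : ℂ) =
        (P.kernel y : ℂ) * ((Real.fourierChar ⟪x, ξ⟫ : ℂ) * (ψ.symmDiff x y : ℂ)) := by
      intro x
      push_cast
      ring
    simp only [e]
    rw [integral_const_mul, ψ.integral_char_mul_symmDiff]
    push_cast
    ring
  rw [ScalarTest.fourierInv_toSchwartz]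
  simp only [hpt]
  -- After the swap the inner x-integral is a Fourier integral of a second difference; its factor 2
  -- cancels the 1/2 of the operator.
  rw [integral_const_mul, integral_integral_swap (P.integrable_kernel_mul_symmDiff ψ ξ)]
  simp only [hy]
  rw [integral_mul_const, integral_complex_ofReal, integral_const_mul, symbol]
  push_cast
  ring

end PeridynamicsModel

end Symbol

/-! ### The weak equation on tensor product test functions -/

section SpaceTimeTests

open scoped FourierTransform

/-- Smooth compactly supported real functions of time. -/
abbrev TimeTest : Type := 𝓓((⊤ : TopologicalSpace.Opens ℝ), ℝ)

/-- The derivative of a test function of time. -/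
def TimeTest.deriv (θ : TimeTest) : TimeTest where
  toFun := _root_.deriv θ
  contDiff' := (contDiff_infty_iff_deriv.1 θ.contDiff).2
  hasCompactSupport' := θ.hasCompactSupport.deriv
  tsupport_subset' := subset_univ _

variable {d : ℕ}

/-- The space-time test function `θ(t) ψ(x) e_i`. -/
def tensorTest (θ : TimeTest) (ψ : ScalarTest d) (i : Fin d) : SpaceTimeTest d where
  toFun p := (θ p.1 * ψ p.2) • EuclideanSpace.single i (1 : ℝ)
  contDiff' := ((θ.contDiff.comp contDiff_fst).mul (ψ.contDiff.comp contDiff_snd)).smul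
    contDiff_const
  hasCompactSupport' :=
    (ScalarTest.hasCompactSupport_mul_prod θ.hasCompactSupport ψ).smul_right
  tsupport_subset' := subset_univ _

lemma tensorTest_apply (θ : TimeTest) (ψ : ScalarTest d) (i : Fin d) (p : ℝ × Rd d) :
    tensorTest θ ψ i p = (θ p.1 * ψ p.2) • EuclideanSpace.single i (1 : ℝ) := rfl

lemma timeDeriv_tensorTest (θ : TimeTest) (ψ : ScalarTest d) (i : Fin d) :
    timeDeriv (tensorTest θ ψ i) = tensorTest θ.deriv ψ i := by
  ext1 p
  rw [timeDeriv, TestFunction.lineDerivOp_eq_lineDerivCLM (𝕜 := ℝ),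
    TestFunction.lineDerivCLM_apply_of_le (by simp)]
  have h : HasDerivAt θ (θ.deriv p.1) p.1 :=
    ((θ.contDiff.differentiable (by simp)) p.1).hasDerivAt
  have h0 : HasDerivAt (fun t : ℝ => p.1 + t) 1 0 := (hasDerivAt_id (0 : ℝ)).const_add p.1
  have h1 : HasDerivAt (fun t => θ (p.1 + t)) (θ.deriv p.1) 0 := by
    have := HasDerivAt.scomp (0 : ℝ) (by simpa using h) h0
    simpa [Function.comp_def] using this
  have h2 : HasLineDerivAt ℝ (tensorTest θ ψ i)
      ((θ.deriv p.1 * ψ p.2) • EuclideanSpace.single i (1 : ℝ)) p (1, 0) := by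
    have := (h1.mul_const (ψ p.2)).smul_const (EuclideanSpace.single i (1 : ℝ))
    simpa [HasLineDerivAt, tensorTest_apply] using this
  exact h2.lineDeriv

lemma PeridynamicsModel.adjointTest_tensorTest [NeZero d] (P : PeridynamicsModel) (θ : TimeTest)
    (ψ : ScalarTest d) (i : Fin d) :
    P.adjointTest (tensorTest θ ψ i) = tensorTest θ (P.scalarOp ψ) i := by
  ext1 p
  change P.adjointOp (fun x => tensorTest θ ψ i (p.1, x)) p.2 = _
  have e : ∀ y, P.kernel y • secondDiff (tensorTest θ ψ i) p y =
      (θ p.1 * (P.kernel y * ψ.symmDiff p.2 y)) • EuclideanSpace.single i (1 : ℝ) := by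
    intro y
    simp only [secondDiff, tensorTest_apply, ← sub_smul, ← add_smul, smul_smul,
      ScalarTest.symmDiff, Prod.fst_add, Prod.snd_add, Prod.fst_sub, Prod.snd_sub, add_zero,
      sub_zero]
    congr 1
    ring
  rw [P.adjointOp_eq, secondInt]
  simp only [e]
  rw [integral_smul_const, integral_const_mul, tensorTest_apply, scalarOp_apply, smul_smul,
    smul_smul, ← neg_smul, coeff]
  congr 1
  ring

lemma slicePairing_tensorTest {s : ℝ} (w : SobolevH d s) (θ : TimeTest) (ψ : ScalarTest d)
    (i : Fin d) (t : ℝ) :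
    slicePairing w (tensorTest θ ψ i) t = θ t * (w.toTempered ψ.toSchwartz i).re := by
  have e : ∀ j, sliceSchwartz (tensorTest θ ψ i) t j =
      if j = i then (θ t : ℂ) • ψ.toSchwartz else 0 := by
    intro j
    ext x
    change (((tensorTest θ ψ i (t, x)) j : ℝ) : ℂ) = _
    split_ifs with hj
    · subst hj
      simp [tensorTest_apply, ScalarTest.toSchwartz_apply]
    · simp [tensorTest_apply, hj]
  rw [slicePairing, Finset.sum_eq_single i]
  · rw [e, if_pos rfl, map_smul]
    simp
  · intro j _ hj
    rw [e, if_neg hj, map_zero]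
    simp
  · simp

/-- `slicePairing` records only real parts; reality of w means nothing is lost, so the real weak
equation becomes a complex one. -/
lemma SobolevH.toTempered_toSchwartz_im {s : ℝ} (w : SobolevH d s) (ψ : ScalarTest d) (i : Fin d) :
    (w.toTempered ψ.toSchwartz i).im = 0 :=
  w.2.2 ψ.toSchwartz (fun x => by simp [ScalarTest.toSchwartz_apply]) i

/-- The weak equation tested with `θ(t) ψ(x) e_i`. -/
lemma IsDistributionalSolution.integral_toTempered_eq [NeZero d] {P : PeridynamicsModel} {s : ℝ}
    {u : SpaceTimeDistribution d} {U : ℝ → SobolevH d s} (hrep : IsRepresentedBy u U)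
    (hsol : IsDistributionalSolution P 0 0 u) (θ : TimeTest) (ψ : ScalarTest d) (i : Fin d) :
    ∫ t in Ioi (0 : ℝ), (θ.deriv.deriv t : ℂ) * (U t).toTempered ψ.toSchwartz i =
      ∫ t in Ioi (0 : ℝ), (θ t : ℂ) * (U t).toTempered (P.scalarOp ψ).toSchwartz i := by
  have e : ∀ (η : TimeTest) (ψ : ScalarTest d) (t : ℝ),
      (η t : ℂ) * (U t).toTempered ψ.toSchwartz i =
        ((slicePairing (U t) (tensorTest η ψ i) t : ℝ) : ℂ) := by
    intro η ψ t
    rw [slicePairing_tensorTest, Complex.ofReal_mul]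
    congr 1
    exact Complex.ext rfl (by simp [SobolevH.toTempered_toSchwartz_im])
  have h := hsol.weak_eq (tensorTest θ ψ i)
  rw [timeDeriv_tensorTest, timeDeriv_tensorTest, P.adjointTest_tensorTest, map_sub,
    (hrep _).2, (hrep _).2] at h
  simp only [e]
  rw [integral_complex_ofReal, integral_complex_ofReal]
  simp only [zero_apply, neg_zero, add_zero, sub_eq_zero] at h
  rw [h]

end SpaceTimeTests

/-! ### Weighted Fourier transform of Sobolev functions -/

section FourierSide

open scoped FourierTransform RealInnerProductSpace

variable {d : ℕ} {s : ℝ}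

/-- Square integrable functions with values in `ℂ^d`. -/
abbrev VectorL2 (d : ℕ) : Type := Lp (EuclideanSpace ℂ (Fin d)) 2 (volume : Measure (Rd d))

/-- The Schwartz function `(1 + |ξ|^2)^(-s/2) 𝓕⁻ψ(ξ)`. -/
def ScalarTest.weightedFourierInv (s : ℝ) (ψ : ScalarTest d) : 𝓢(Rd d, ℂ) :=
  SchwartzMap.smulLeftCLM ℂ (fun ξ : Rd d => (((1 + ‖ξ‖ ^ 2) ^ (-s / 2) : ℝ) : ℂ))
    (𝓕⁻ ψ.toSchwartz)

lemma ScalarTest.weightedFourierInv_apply (ψ : ScalarTest d) (ξ : Rd d) :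
    ψ.weightedFourierInv s ξ =
      (((1 + ‖ξ‖ ^ 2) ^ (-s / 2) : ℝ) : ℂ) * 𝓕⁻ ψ.toSchwartz ξ := by
  rw [weightedFourierInv, SchwartzMap.smulLeftCLM_apply_apply (by fun_prop), smul_eq_mul]

/-- The function `(1 + |ξ|^2)^(s/2) 𝓕w(ξ)`. -/
def SobolevH.weightedFourier (w : SobolevH d s) : VectorL2 d := 𝓕 w.toL2

lemma SobolevH.norm_weightedFourier (w : SobolevH d s) : ‖w.weightedFourier‖ = ‖w‖ :=
  Lp.norm_fourier_eq _

lemma SobolevH.weightedFourier_eq_zero_iff (w : SobolevH d s) : w.weightedFourier = 0 ↔ w = 0 := by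
  rw [← norm_eq_zero, norm_weightedFourier, norm_eq_zero]

lemma SobolevH.continuous_weightedFourier :
    Continuous (SobolevH.weightedFourier : SobolevH d s → VectorL2 d) := by
  have h1 : Isometry (SobolevH.toL2Hom : SobolevH d s →+ VectorL2 d) :=
    AddMonoidHomClass.isometry_of_norm _ fun w => rfl
  exact (Lp.fourierTransformₗᵢ (Rd d) (EuclideanSpace ℂ (Fin d))).continuous.comp h1.continuous

/-- By transposition the inverse transform and the weight fall on the test function, whence 𝓕⁻ψ and
the exponent -s/2. -/
lemma SobolevH.toTempered_toSchwartz (w : SobolevH d s) (ψ : ScalarTest d) :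
    w.toTempered ψ.toSchwartz = ∫ ξ, ψ.weightedFourierInv s ξ • w.weightedFourier ξ := by
  have h := (TemperedDistribution.besselPotential_neg_apply_eq_iff s
    (w.toL2 : VectorTempered d) w.toTempered).2 w.toL2_spec
  rw [← h, TemperedDistribution.besselPotential,
    TemperedDistribution.fourierMultiplierCLM_apply_apply, ← TemperedDistribution.fourier_apply,
    Lp.fourier_toTemperedDistribution_eq, Lp.toTemperedDistribution_apply]
  rfl

end FourierSide

/-! ### Test functions determine L² functions of frequency -/

section Injectivity

open scoped FourierTransform RealInnerProductSpace

variable {d : ℕ} {s : ℝ}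

/-- An integrable function with vanishing Fourier transform is zero. -/
lemma ae_eq_zero_of_fourier_eq_zero {W : Rd d → ℂ} (hW : Integrable W)
    (h : ∀ a, 𝓕 W a = 0) : W =ᵐ[volume] 0 := by
  refine ae_eq_zero_of_integral_contDiff_smul_eq_zero hW.locallyIntegrable fun g hg hgc => ?_
  have hg₁ : HasCompactSupport (Complex.ofRealCLM ∘ g) := hgc.comp_left rfl
  have hg₂ : ContDiff ℝ ∞ (Complex.ofRealCLM ∘ g) := by fun_prop
  let η : 𝓢(Rd d, ℂ) := hg₁.toSchwartzMap hg₂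
  -- The Fourier transform moves across the integral: ∫ 𝓕W · 𝓕⁻η = ∫ W · η, and the left side
  -- vanishes.
  have key := VectorFourier.integral_fourierIntegral_smul_eq_flip (L := innerₗ (Rd d))
    (μ := volume) (ν := volume) Real.continuous_fourierChar continuous_inner hW
    ((𝓕⁻ η).integrable (μ := volume))
  have e1 : ∀ ξ, VectorFourier.fourierIntegral Real.fourierChar volume (innerₗ (Rd d)) W ξ = 0 := h
  have e2 : ∀ ξ, VectorFourier.fourierIntegral Real.fourierChar volume (innerₗ (Rd d)).flip
      (𝓕⁻ η : 𝓢(Rd d, ℂ)) ξ = η ξ := by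
    intro ξ
    rw [flip_innerₗ]
    change 𝓕 ((𝓕⁻ η : 𝓢(Rd d, ℂ)) : Rd d → ℂ) ξ = η ξ
    rw [← SchwartzMap.fourier_coe, FourierTransform.fourier_fourierInv_eq]
  simp only [e1, e2, zero_smul, integral_zero] at key
  rw [key]
  congr 1 with x
  change (g x : ℝ) • W x = W x • ((g x : ℝ) : ℂ)
  rw [Complex.real_smul, smul_eq_mul, mul_comm]

/-- The translate `x ↦ ψ(x + a)`. -/
def ScalarTest.translate (ψ : ScalarTest d) (a : Rd d) : ScalarTest d where
  toFun x := ψ (x + a)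
  contDiff' := ψ.contDiff.comp (contDiff_id.add contDiff_const)
  hasCompactSupport' := ψ.hasCompactSupport.comp_homeomorph (Homeomorph.addRight a)
  tsupport_subset' := subset_univ _

lemma ScalarTest.weightedFourierInv_translate (ψ : ScalarTest d) (a ξ : Rd d) :
    (ψ.translate a).weightedFourierInv s ξ =
      (Real.fourierChar (-⟪ξ, a⟫) : ℂ) * ψ.weightedFourierInv s ξ := by
  have h : 𝓕⁻ (ψ.translate a).toSchwartz ξ =
      (Real.fourierChar (-⟪ξ, a⟫) : ℂ) * 𝓕⁻ ψ.toSchwartz ξ := by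
    rw [fourierInv_toSchwartz, real_inner_comm, ← integral_char_mul_comp_add]
    rfl
  rw [weightedFourierInv_apply, weightedFourierInv_apply, h]
  ring

/-- Some test function has an inverse Fourier transform without zeros on a given ball. -/
lemma ScalarTest.exists_fourierInv_ne_zero (R : ℝ) :
    ∃ ψ : ScalarTest d, ∀ ξ, ‖ξ‖ < R → 𝓕⁻ ψ.toSchwartz ξ ≠ 0 := by
  -- For |x| < ε and |ξ| < R the phase satisfies |2π⟪x, ξ⟫| ≤ 2πεR < π/2, so its cosine is positive
  -- on the support of a bump of radius ε.
  obtain ⟨ε, hε, hεR⟩ : ∃ ε : ℝ, 0 < ε ∧ 4 * ε * R < 1 := by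
    refine ⟨1 / (4 * (|R| + 1)), by positivity, ?_⟩
    have : R < |R| + 1 := by linarith [le_abs_self R]
    have h2 : 4 * (1 / (4 * (|R| + 1))) * R = R / (|R| + 1) := by field_simp
    rw [h2, div_lt_one (by positivity)]
    exact this
  let b : ContDiffBump (0 : Rd d) := ⟨ε / 2, ε, by positivity, by linarith⟩
  let ψ : ScalarTest d := ⟨b, b.contDiff, b.hasCompactSupport, subset_univ _⟩
  refine ⟨ψ, fun ξ hξ h0 => ?_⟩
  have hre : (𝓕⁻ ψ.toSchwartz ξ).re = ∫ x, Real.cos (2 * Real.pi * ⟪x, ξ⟫) * b x := by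
    rw [fourierInv_toSchwartz]
    refine (integral_re (ψ.integrable_char_mul ξ)).symm.trans ?_
    congr 1 with x
    change ((Real.fourierChar ⟪x, ξ⟫ : ℂ) * (b x : ℂ)).re = _
    rw [Complex.re_mul_ofReal, Real.fourierChar_apply, Complex.exp_ofReal_mul_I_re]
  have hcos : ∀ x ∈ Function.support b, 0 < Real.cos (2 * Real.pi * ⟪x, ξ⟫) := by
    intro x hx
    rw [b.support_eq, mem_ball_zero_iff] at hx
    have h1 : |⟪x, ξ⟫| ≤ ε * R :=
      (abs_real_inner_le_norm x ξ).trans (mul_le_mul hx.le hξ.le (norm_nonneg _) hε.le)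
    have h2 := abs_le.1 h1
    apply Real.cos_pos_of_mem_Ioo
    constructor <;> nlinarith [Real.pi_pos]
  have hnn : 0 ≤ fun x => Real.cos (2 * Real.pi * ⟪x, ξ⟫) * b x := by
    intro x
    by_cases hx : b x = 0
    · simp [hx]
    · exact mul_nonneg (hcos x hx).le b.nonneg
  have hint : Integrable fun x => Real.cos (2 * Real.pi * ⟪x, ξ⟫) * b x := by
    have hb : Continuous b := b.continuous
    exact Continuous.integrable_of_hasCompactSupport (by fun_prop) b.hasCompactSupport.mul_left
  have hpos : 0 < ∫ x, Real.cos (2 * Real.pi * ⟪x, ξ⟫) * b x := by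
    rw [integral_pos_iff_support_of_nonneg hnn hint]
    refine lt_of_lt_of_le (Metric.measure_ball_pos volume (0 : Rd d) hε) (measure_mono fun x hx => ?_)
    have hx' : x ∈ Function.support b := by
      rw [b.support_eq]
      exact hx
    exact mul_ne_zero (hcos x hx').ne' hx'
  rw [← hre, h0] at hpos
  simp at hpos

lemma memLp_component (X : VectorL2 d) (i : Fin d) : MemLp (fun ξ => X ξ i) 2 volume :=
  (Lp.memLp X).continuousLinearMap_comp (EuclideanSpace.proj (𝕜 := ℂ) i)

lemma integrable_schwartz_mul_component (q : 𝓢(Rd d, ℂ)) (X : VectorL2 d) (i : Fin d) :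
    Integrable fun ξ => q ξ * X ξ i :=
  (q.memLp 2 volume).integrable_mul (memLp_component X i)

lemma integrable_schwartz_smul (q : 𝓢(Rd d, ℂ)) (X : VectorL2 d) :
    Integrable fun ξ => q ξ • X ξ :=
  memLp_one_iff_integrable.1 ((Lp.memLp X).smul (q.memLp 2 volume))

lemma PeridynamicsModel.weightedFourierInv_scalarOp [NeZero d] (P : PeridynamicsModel)
    (ψ : ScalarTest d) (ξ : Rd d) :
    (P.scalarOp ψ).weightedFourierInv s ξ = (P.symbol ξ : ℂ) * ψ.weightedFourierInv s ξ := by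
  rw [ScalarTest.weightedFourierInv_apply, ScalarTest.weightedFourierInv_apply,
    P.fourierInv_scalarOp]
  ring

/-- If `X` and `symbol • Y` agree when paired with all test functions, they are equal. -/
lemma PeridynamicsModel.ae_eq_symbol_smul [NeZero d] (P : PeridynamicsModel) {X Y : VectorL2 d}
    (h : ∀ (ψ : ScalarTest d) (i : Fin d), ∫ ξ, ψ.weightedFourierInv s ξ * X ξ i =
      ∫ ξ, (P.scalarOp ψ).weightedFourierInv s ξ * Y ξ i) :
    ∀ᵐ ξ, X ξ = (P.symbol ξ : ℂ) • Y ξ := by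
  have key : ∀ (ψ : ScalarTest d) (i : Fin d),
      ∀ᵐ ξ, ψ.weightedFourierInv s ξ * (X ξ i - (P.symbol ξ : ℂ) * Y ξ i) = 0 := by
    intro ψ i
    -- The unbounded symbol is absorbed into the Schwartz function of `scalarOp ψ`, so each term is
    -- a product of L² functions.
    have e : ∀ (ψ : ScalarTest d) (ξ : Rd d),
        ψ.weightedFourierInv s ξ * (X ξ i - (P.symbol ξ : ℂ) * Y ξ i) =
        ψ.weightedFourierInv s ξ * X ξ i - (P.scalarOp ψ).weightedFourierInv s ξ * Y ξ i := by
      intro ψ ξ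
      rw [P.weightedFourierInv_scalarOp]
      ring
    have hint : ∀ ψ : ScalarTest d, Integrable fun ξ =>
        ψ.weightedFourierInv s ξ * (X ξ i - (P.symbol ξ : ℂ) * Y ξ i) := fun ψ => by
      simp only [e]
      exact (integrable_schwartz_mul_component _ X i).sub (integrable_schwartz_mul_component _ Y i)
    -- The Fourier transform at a is the hypothesis for the translate of ψ by a.
    refine ae_eq_zero_of_fourier_eq_zero (hint ψ) fun a => ?_
    rw [Real.fourier_eq]
    have h1 : ∀ ξ, Real.fourierChar (-⟪ξ, a⟫) •
        (ψ.weightedFourierInv s ξ * (X ξ i - (P.symbol ξ : ℂ) * Y ξ i)) =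
        (ψ.translate a).weightedFourierInv s ξ * X ξ i -
          (P.scalarOp (ψ.translate a)).weightedFourierInv s ξ * Y ξ i := by
      intro ξ
      rw [← e, ψ.weightedFourierInv_translate, Circle.smul_def, smul_eq_mul, mul_assoc]
    simp only [h1]
    rw [integral_sub (integrable_schwartz_mul_component _ X i)
      (integrable_schwartz_mul_component _ Y i), h, sub_self]
  -- One ψ per integer radius: each can be divided out on its own ball, and countably many null sets
  -- suffice.
  choose ψ hψ using fun R : ℕ => ScalarTest.exists_fourierInv_ne_zero (d := d) R
  have hall := ae_all_iff.2 fun R : ℕ => ae_all_iff.2 fun i : Fin d => key (ψ R) i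
  filter_upwards [hall] with ξ hξ
  obtain ⟨R, hR⟩ := exists_nat_gt ‖ξ‖
  ext i
  have h1 := hξ R i
  have h2 : (ψ R).weightedFourierInv s ξ ≠ 0 := by
    rw [ScalarTest.weightedFourierInv_apply]
    refine mul_ne_zero ?_ (hψ R ξ hR)
    exact_mod_cast (Real.rpow_pos_of_pos (by positivity) _).ne'
  simpa [sub_eq_zero] using (mul_eq_zero.1 h1).resolve_left h2

/-- Pairing with a Schwartz function, as a continuous linear map on `L^2`. -/
def schwartzPairing (q : 𝓢(Rd d, ℂ)) (i : Fin d) : VectorL2 d →L[ℂ] ℂ :=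
  (EuclideanSpace.proj (𝕜 := ℂ) i) ∘L (PointwiseConvergenceCLM.evalCLM (RingHom.id ℂ) _ q) ∘L
    Lp.toTemperedDistributionCLM (EuclideanSpace ℂ (Fin d)) (volume : Measure (Rd d)) 2

lemma schwartzPairing_apply (q : 𝓢(Rd d, ℂ)) (i : Fin d) (X : VectorL2 d) :
    schwartzPairing q i X = ∫ ξ, q ξ * X ξ i := by
  change ((X : VectorTempered d) q) i = _
  rw [Lp.toTemperedDistribution_apply]
  have := (EuclideanSpace.proj (𝕜 := ℂ) i).integral_comp_comm (integrable_schwartz_smul q X)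
  simpa using this.symm

lemma SobolevH.schwartzPairing_weightedFourier (w : SobolevH d s) (ψ : ScalarTest d) (i : Fin d) :
    schwartzPairing (ψ.weightedFourierInv s) i w.weightedFourier =
      w.toTempered ψ.toSchwartz i := by
  rw [w.toTempered_toSchwartz]
  change ((w.weightedFourier : VectorTempered d) _) i = _
  rw [Lp.toTemperedDistribution_apply]

/-- The weak equation on the Fourier side. -/
lemma IsDistributionalSolution.ae_integral_weightedFourier_eq [NeZero d] {P : PeridynamicsModel}
    {u : SpaceTimeDistribution d} {U : ℝ → SobolevH d s} (hrep : IsRepresentedBy u U)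
    (hsol : IsDistributionalSolution P 0 0 u) (θ : TimeTest)
    (h0 : IntegrableOn (fun t => θ t • (U t).weightedFourier) (Ioi 0))
    (h2 : IntegrableOn (fun t => θ.deriv.deriv t • (U t).weightedFourier) (Ioi 0)) :
    ∀ᵐ ξ, (∫ t in Ioi (0 : ℝ), θ.deriv.deriv t • (U t).weightedFourier) ξ =
      (P.symbol ξ : ℂ) • (∫ t in Ioi (0 : ℝ), θ t • (U t).weightedFourier) ξ := by
  have e : ∀ (η : TimeTest) (ψ : ScalarTest d) (i : Fin d),
      IntegrableOn (fun t => η t • (U t).weightedFourier) (Ioi 0) →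
      ∫ ξ, ψ.weightedFourierInv s ξ *
        (∫ t in Ioi (0 : ℝ), η t • (U t).weightedFourier : VectorL2 d) ξ i =
      ∫ t in Ioi (0 : ℝ), (η t : ℂ) * (U t).toTempered ψ.toSchwartz i := by
    intro η ψ i hη
    rw [← schwartzPairing_apply, ← ContinuousLinearMap.integral_comp_comm _ hη]
    congr 1 with t
    rw [ContinuousLinearMap.map_smul_of_tower, SobolevH.schwartzPairing_weightedFourier,
      Complex.real_smul]
  refine P.ae_eq_symbol_smul (s := s) fun ψ i => ?_
  rw [e _ _ _ h2, e _ _ _ h0]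
  exact hsol.integral_toTempered_eq hrep θ ψ i

end Injectivity

/-! ### Bounded multipliers and frequency truncation -/

section Multipliers

open scoped ENNReal

variable {d : ℕ}

/-- Multiplication by a bounded real function on `L^2`. -/
def boundedMultiplier (b : Rd d → ℝ) (hb : MemLp (fun ξ => (b ξ : ℂ)) ∞ volume) :
    VectorL2 d →L[ℂ] VectorL2 d :=
  (ContinuousLinearMap.lsmul ℂ ℂ).holderL volume ∞ 2 2 hb.toLp

variable {b : Rd d → ℝ} (hb : MemLp (fun ξ => (b ξ : ℂ)) ∞ volume)

lemma coeFn_boundedMultiplier (X : VectorL2 d) :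
    boundedMultiplier b hb X =ᵐ[volume] fun ξ => (b ξ : ℂ) • X ξ := by
  have h := (ContinuousLinearMap.lsmul ℂ ℂ (E := EuclideanSpace ℂ (Fin d))).coeFn_holder
    (r := 2) (hb.toLp) X
  filter_upwards [h, hb.coeFn_toLp] with ξ h1 h2
  rw [h2] at h1
  exact h1

lemma inner_boundedMultiplier (X Y : VectorL2 d) :
    inner ℂ (boundedMultiplier b hb X) Y = inner ℂ X (boundedMultiplier b hb Y) := by
  rw [L2.inner_def, L2.inner_def]
  refine integral_congr_ae ?_
  filter_upwards [coeFn_boundedMultiplier hb X, coeFn_boundedMultiplier hb Y] with ξ h1 h2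
  rw [h1, h2, inner_smul_left, inner_smul_right, Complex.conj_ofReal]

lemma re_inner_boundedMultiplier_nonpos (hb0 : ∀ ξ, b ξ ≤ 0) (X : VectorL2 d) :
    RCLike.re (inner ℂ (boundedMultiplier b hb X) X) ≤ 0 := by
  rw [L2.inner_def, ← integral_re (L2.integrable_inner _ _)]
  refine integral_nonpos_of_ae ?_
  filter_upwards [coeFn_boundedMultiplier hb X] with ξ h1
  rw [h1, inner_smul_left, Complex.conj_ofReal, inner_self_eq_norm_sq_to_K]
  have := mul_nonpos_of_nonpos_of_nonneg (hb0 ξ) (sq_nonneg ‖X ξ‖)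
  have e : RCLike.re ((b ξ : ℂ) * ((‖X ξ‖ : ℝ) : ℂ) ^ 2) = b ξ * ‖X ξ‖ ^ 2 := by
    rw [← Complex.ofReal_pow, ← Complex.ofReal_mul]
    rfl
  exact e.le.trans this

lemma memLp_top_indicator_ball {b : Rd d → ℝ} (hbm : Measurable b) {R C : ℝ}
    (hC : ∀ ξ, ‖ξ‖ < R → |b ξ| ≤ C) :
    MemLp (fun ξ => (((Metric.ball (0 : Rd d) R).indicator b ξ : ℝ) : ℂ)) ∞ volume := by
  refine memLp_top_of_bound (C := max C 0) (Complex.measurable_ofReal.comp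
    (hbm.indicator Metric.isOpen_ball.measurableSet)).aestronglyMeasurable
    (Eventually.of_forall fun ξ => ?_)
  rw [Complex.norm_real, Real.norm_eq_abs]
  by_cases hξ : ξ ∈ Metric.ball (0 : Rd d) R
  · rw [indicator_of_mem hξ]
    exact (hC ξ (by simpa using hξ)).trans (le_max_left _ _)
  · rw [indicator_of_notMem hξ]
    simp

/-- Restriction to the ball of radius `R`. -/
def ballCutoff (R : ℝ) : VectorL2 d →L[ℂ] VectorL2 d :=
  boundedMultiplier ((Metric.ball (0 : Rd d) R).indicator fun _ => 1)
    (memLp_top_indicator_ball measurable_const (C := 1) (by simp))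

lemma coeFn_ballCutoff (R : ℝ) (X : VectorL2 d) :
    ballCutoff R X =ᵐ[volume] (Metric.ball (0 : Rd d) R).indicator X := by
  filter_upwards [coeFn_boundedMultiplier (memLp_top_indicator_ball measurable_const (C := 1)
    (b := fun _ => 1) (R := R) (by simp)) X] with ξ h
  rw [ballCutoff, h]
  by_cases hξ : ξ ∈ Metric.ball (0 : Rd d) R <;> simp [hξ]

lemma norm_ballCutoff_le (R : ℝ) (X : VectorL2 d) : ‖ballCutoff R X‖ ≤ ‖X‖ := by
  refine Lp.norm_le_norm_of_ae_le ?_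
  filter_upwards [coeFn_ballCutoff R X] with ξ h
  rw [h]
  exact norm_indicator_le_norm_self _ _

lemma norm_sq_eq_integral (X : VectorL2 d) : ‖X‖ ^ 2 = ∫ ξ, ‖X ξ‖ ^ 2 := by
  rw [← inner_self_eq_norm_sq (𝕜 := ℂ), L2.inner_def, ← integral_re (L2.integrable_inner _ _)]
  simp only [inner_self_eq_norm_sq]

/-- Removes the truncation from bounds uniform in R: the integrals of ‖X‖² over growing balls
converge to ‖X‖². -/
lemma norm_le_of_norm_ballCutoff_le {X : VectorL2 d} {C : ℝ}
    (h : ∀ R : ℕ, ‖ballCutoff R X‖ ≤ C) : ‖X‖ ≤ C := by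
  have hC : 0 ≤ C := (norm_nonneg _).trans (h 0)
  refine le_of_sq_le_sq ?_ hC
  have hU : (⋃ R : ℕ, Metric.ball (0 : Rd d) R) = univ := Metric.iUnion_ball_nat 0
  have hint : Integrable fun ξ => ‖X ξ‖ ^ 2 := (Lp.memLp X).integrable_norm_pow (by simp)
  have hlim := tendsto_setIntegral_of_monotone (μ := volume) (f := fun ξ => ‖X ξ‖ ^ 2)
    (s := fun R : ℕ => Metric.ball (0 : Rd d) R)
    (fun R => Metric.isOpen_ball.measurableSet)
    (fun R R' hR => Metric.ball_subset_ball (by exact_mod_cast hR)) hint.integrableOn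
  rw [hU, setIntegral_univ, ← norm_sq_eq_integral] at hlim
  refine le_of_tendsto hlim (Eventually.of_forall fun R => ?_)
  have e : ∫ ξ in Metric.ball (0 : Rd d) R, ‖X ξ‖ ^ 2 = ‖ballCutoff R X‖ ^ 2 := by
    rw [norm_sq_eq_integral, ← integral_indicator Metric.isOpen_ball.measurableSet]
    refine integral_congr_ae ?_
    filter_upwards [coeFn_ballCutoff R X] with ξ h
    rw [h]
    by_cases hξ : ξ ∈ Metric.ball (0 : Rd d) R
    · simp only [indicator_of_mem hξ]
    · simp only [indicator_of_notMem hξ]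
      simp
  rw [e]
  exact pow_le_pow_left₀ (norm_nonneg _) (h R) 2

namespace PeridynamicsModel

variable (P : PeridynamicsModel) [NeZero d]

lemma memLp_top_symbol_indicator (R : ℝ) :
    MemLp (fun ξ => (((Metric.ball (0 : Rd d) R).indicator P.symbol ξ : ℝ) : ℂ)) ∞ volume := by
  obtain ⟨C, hC⟩ := P.abs_symbol_le (d := d)
  refine memLp_top_indicator_ball P.symbol_measurable (C := |C| * R ^ 2) fun ξ hξ => ?_
  refine (hC ξ).trans ?_
  gcongr
  exact le_abs_self C

/-- Multiplication by the symbol, truncated to the ball of radius `R`. -/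
def truncatedOp (R : ℝ) : VectorL2 d →L[ℂ] VectorL2 d :=
  boundedMultiplier _ (P.memLp_top_symbol_indicator R)

lemma ballCutoff_eq_truncatedOp {X Y : VectorL2 d} (R : ℝ)
    (h : ∀ᵐ ξ, X ξ = (P.symbol ξ : ℂ) • Y ξ) :
    ballCutoff R X = P.truncatedOp R (ballCutoff R Y) := by
  refine Lp.ext ?_
  filter_upwards [h, coeFn_ballCutoff R X, coeFn_ballCutoff R Y,
    coeFn_boundedMultiplier (P.memLp_top_symbol_indicator R) (ballCutoff R Y)] with ξ h0 h1 h2 h3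
  rw [truncatedOp, h3, h1, h2]
  by_cases hξ : ξ ∈ Metric.ball (0 : Rd d) R
  · simp [hξ, h0]
  · simp [hξ]

lemma truncatedOp_symm (R : ℝ) (X Y : VectorL2 d) :
    inner ℂ (P.truncatedOp R X) Y = inner ℂ X (P.truncatedOp R Y) :=
  inner_boundedMultiplier _ X Y

lemma truncatedOp_nonpos (R : ℝ) (X : VectorL2 d) :
    RCLike.re (inner ℂ (P.truncatedOp R X) X) ≤ 0 :=
  re_inner_boundedMultiplier_nonpos _ (fun ξ => indicator_nonpos (fun ξ _ => P.symbol_nonpos ξ) ξ) X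

end PeridynamicsModel

end Multipliers

/-! ### Integrability up to time zero and uniqueness -/

section Uniqueness

lemma ae_comp_add_right {p : ℝ → Prop} (h : ∀ᵐ t, p t) (c : ℝ) : ∀ᵐ t, p (t + c) :=
  (measurePreserving_add_right volume c).quasiMeasurePreserving.ae h

lemma integrableOn_comp_add_right_Ioc {E : Type*} [NormedAddCommGroup E] {f : ℝ → E} {a b c : ℝ}
    (hf : IntegrableOn f (Ioc (a + c) (b + c))) : IntegrableOn (fun t => f (t + c)) (Ioc a b) := by
  have h := (measurePreserving_add_right volume c).integrableOn_comp_preimage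
    (measurableEmbedding_addRight c) (f := f) (s := Ioc (a + c) (b + c))
  rw [preimage_add_const_Ioc, add_sub_cancel_right, add_sub_cancel_right] at h
  exact h.2 hf

lemma locallyIntegrableOn_weightedFourier {d : ℕ} {s : ℝ} {U : ℝ → SobolevH d s}
    (hU : LocallyIntegrableOn U (Ioi (0 : ℝ)) volume) :
    LocallyIntegrableOn (fun t => (U t).weightedFourier) (Ioi (0 : ℝ)) volume := by
  intro t ht
  obtain ⟨S, hS, hint⟩ := hU t ht
  refine ⟨S, hS, Integrable.mono hint
    (SobolevH.continuous_weightedFourier.comp_aestronglyMeasurable hint.1)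
    (Eventually.of_forall fun t => (SobolevH.norm_weightedFourier _).le)⟩

lemma locallyIntegrable_indicator_Ioi {E : Type*} [NormedAddCommGroup E] {f : ℝ → E} {a : ℝ}
    (h : ∀ b, IntegrableOn f (Ioc a b)) : LocallyIntegrable ((Ioi a).indicator f) volume := by
  refine locallyIntegrable_iff.2 fun K hK => ?_
  obtain ⟨b, hb⟩ := hK.bddAbove
  rw [IntegrableOn, integrable_indicator_iff measurableSet_Ioi, IntegrableOn,
    Measure.restrict_restrict measurableSet_Ioi]
  exact (h b).mono_set fun t ht => ⟨ht.1, hb ht.2⟩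

variable {d : ℕ} [NeZero d] {s : ℝ} {P : PeridynamicsModel} {u : SpaceTimeDistribution d}
  {U : ℝ → SobolevH d s}

/-- The weak equation for the truncated Fourier side, for functions agreeing with the solution
where the test function does not vanish. -/
lemma IsDistributionalSolution.integral_ballCutoff_eq (hrep : IsRepresentedBy u U)
    (hsol : IsDistributionalSolution P 0 0 u) (R : ℝ) (θ : TimeTest) {S : Set ℝ}
    (hS : S ⊆ Ioi 0)
    (hG : LocallyIntegrable (S.indicator fun t => (U t).weightedFourier) volume)
    (hθ : ∀ t ∈ Ioi (0 : ℝ), t ∉ S → θ t = 0 ∧ θ.deriv.deriv t = 0) :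
    ∫ t, θ.deriv.deriv t • ballCutoff R (S.indicator (fun t => (U t).weightedFourier) t) =
      P.truncatedOp R (∫ t, θ t • ballCutoff R (S.indicator (fun t => (U t).weightedFourier) t)) := by
  have key : ∀ η : TimeTest, (∀ t ∈ Ioi (0 : ℝ), t ∉ S → η t = 0) →
      IntegrableOn (fun t => η t • (U t).weightedFourier) (Ioi 0) ∧
      ∫ t, η t • ballCutoff R (S.indicator (fun t => (U t).weightedFourier) t) =
        ballCutoff R (∫ t in Ioi (0 : ℝ), η t • (U t).weightedFourier) := by
    intro η hη
    have hint := hG.integrable_smul_left_of_hasCompactSupport η.continuous η.hasCompactSupport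
    have e : (fun t => η t • S.indicator (fun t => (U t).weightedFourier) t) =
        (Ioi (0 : ℝ)).indicator fun t => η t • (U t).weightedFourier := by
      ext1 t
      by_cases hS' : t ∈ S
      · rw [indicator_of_mem hS', indicator_of_mem (hS hS')]
      · rw [indicator_of_notMem hS', smul_zero]
        by_cases ht : t ∈ Ioi (0 : ℝ)
        · rw [indicator_of_mem ht, hη t ht hS', zero_smul]
        · rw [indicator_of_notMem ht]
    have hint' := hint
    rw [e, integrable_indicator_iff measurableSet_Ioi] at hint'
    refine ⟨hint', ?_⟩
    rw [← integral_indicator measurableSet_Ioi, ← e, ← ContinuousLinearMap.integral_comp_comm _ hint]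
    simp only [ContinuousLinearMap.map_smul_of_tower]
  obtain ⟨h0, e0⟩ := key θ fun t ht hS' => (hθ t ht hS').1
  obtain ⟨h2, e2⟩ := key θ.deriv.deriv fun t ht hS' => (hθ t ht hS').2
  rw [e0, e2]
  exact P.ballCutoff_eq_truncatedOp R (hsol.ae_integral_weightedFourier_eq hrep θ h0 h2)

/-- The symmetric sum inequality for the truncated Fourier side. -/
lemma IsDistributionalSolution.ae_norm_ballCutoff_symmetric_sum_le (hrep : IsRepresentedBy u U)
    (hsol : IsDistributionalSolution P 0 0 u) (R : ℝ) {a b : ℝ} (ha : 0 ≤ a) (hab : a ≤ b ∨ a = 0)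
    (hG : LocallyIntegrable ((Ioi a).indicator fun t => (U t).weightedFourier) volume)
    {h : ℝ} (hh : 0 ≤ h) :
    ∀ᵐ t, b + h < t →
      ‖ballCutoff R ((Ioi a).indicator (fun t => (U t).weightedFourier) (t + h)) +
        ballCutoff R ((Ioi a).indicator (fun t => (U t).weightedFourier) (t - h))‖ ≤
      2 * ‖ballCutoff R ((Ioi a).indicator (fun t => (U t).weightedFourier) t)‖ := by
  refine ae_norm_symmetric_sum_le (𝕜 := ℂ) (M := (P.truncatedOp (d := d) R).restrictScalars ℝ)
    (P.truncatedOp_symm R) (P.truncatedOp_nonpos R)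
    (g := fun t => ballCutoff R ((Ioi a).indicator (fun t => (U t).weightedFourier) t))
    (fun t => ?_) (fun θ hθ hθc hsupp => ?_) hh
  · obtain ⟨S, hS, hint⟩ := hG t
    exact ⟨S, hS, (ballCutoff R).integrable_comp hint⟩
  · refine hsol.integral_ballCutoff_eq hrep R ⟨θ, hθ, hθc, subset_univ _⟩ (Ioi_subset_Ioi ha) hG
      fun t ht hta => ?_
    have hnot : t ∉ tsupport θ := by
      -- Either θ is supported beyond b ≥ a, or a = 0 and no positive time is lost. In the second
      -- case θ may meet t ≤ 0, which vanishing initial data permit.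
      rcases hab with hab | rfl
      · exact fun h => hta (lt_of_le_of_lt hab (hsupp h))
      · exact absurd ht hta
    refine ⟨image_eq_zero_of_notMem_tsupport hnot, ?_⟩
    have : t ∉ tsupport (deriv (deriv θ)) := fun h =>
      hnot (tsupport_deriv_subset (tsupport_deriv_subset h))
    exact image_eq_zero_of_notMem_tsupport this

/-- A solution is controlled near the initial time by its values at later times. -/
lemma IsDistributionalSolution.ae_norm_weightedFourier_le
    (hU : LocallyIntegrableOn U (Ioi (0 : ℝ)) volume) (hrep : IsRepresentedBy u U)
    (hsol : IsDistributionalSolution P 0 0 u) :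
    ∀ᵐ t, 0 < t → ‖(U t).weightedFourier‖ ≤
      2 * ‖(U (t + 1)).weightedFourier‖ + ‖(U (t + 2)).weightedFourier‖ := by
  have hg := locallyIntegrableOn_weightedFourier hU
  have h : ∀ R n : ℕ, ∀ᵐ t, 1 / ((n : ℝ) + 1) < t → ‖ballCutoff R (U t).weightedFourier‖ ≤
      2 * ‖(U (t + 1)).weightedFourier‖ + ‖(U (t + 2)).weightedFourier‖ := by
    intro R n
    -- Cutting at a positive time is forced: integrability up to 0 is what is being proved.
    have hpos : (0 : ℝ) < 1 / ((n : ℝ) + 1) := by positivity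
    set a : ℝ := 1 / ((n : ℝ) + 1)
    have hG : LocallyIntegrable ((Ioi a).indicator fun t => (U t).weightedFourier) volume :=
      locallyIntegrable_indicator_Ioi fun b =>
        (hg.integrableOn_compact_subset (fun t ht => lt_of_lt_of_le hpos ht.1)
          (isCompact_Icc (a := a) (b := b))).mono_set Ioc_subset_Icc_self
    -- Centre t + 1, step 1: the times involved are t, t + 1, t + 2.
    have := ae_comp_add_right (hsol.ae_norm_ballCutoff_symmetric_sum_le hrep R hpos.le
      (Or.inl le_rfl) hG zero_le_one) 1
    filter_upwards [this] with t ht hat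
    have h1 := ht (by linarith)
    rw [add_sub_cancel_right, add_assoc, one_add_one_eq_two,
      indicator_of_mem (show t + 2 ∈ Ioi a from by simp only [mem_Ioi]; linarith),
      indicator_of_mem (show t + 1 ∈ Ioi a from by simp only [mem_Ioi]; linarith),
      indicator_of_mem (show t ∈ Ioi a from hat)] at h1
    have h2 := norm_sub_le (ballCutoff R (U (t + 2)).weightedFourier +
      ballCutoff R (U t).weightedFourier) (ballCutoff R (U (t + 2)).weightedFourier)
    rw [add_sub_cancel_left] at h2
    linarith [norm_ballCutoff_le R (U (t + 2)).weightedFourier,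
      norm_ballCutoff_le R (U (t + 1)).weightedFourier]
  have h' := ae_all_iff.2 fun R : ℕ => ae_all_iff.2 fun n : ℕ => h R n
  filter_upwards [h'] with t ht ht0
  refine norm_le_of_norm_ballCutoff_le fun R => ?_
  obtain ⟨n, hn⟩ := exists_nat_one_div_lt ht0
  exact ht R n hn

/-- A solution is locally integrable up to the initial time. -/
lemma IsDistributionalSolution.integrableOn_weightedFourier
    (hU : LocallyIntegrableOn U (Ioi (0 : ℝ)) volume) (hrep : IsRepresentedBy u U)
    (hsol : IsDistributionalSolution P 0 0 u) (b : ℝ) :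
    IntegrableOn (fun t => (U t).weightedFourier) (Ioc 0 b) := by
  have hg := locallyIntegrableOn_weightedFourier hU
  have hshift : ∀ c : ℝ, 0 < c →
      IntegrableOn (fun t => ‖(U (t + c)).weightedFourier‖) (Ioc 0 b) := fun c hc => by
    refine (integrableOn_comp_add_right_Ioc (f := fun t => (U t).weightedFourier) (c := c) ?_).norm
    exact (hg.integrableOn_compact_subset (fun t ht => lt_of_lt_of_le (by linarith) ht.1)
      (isCompact_Icc (a := 0 + c) (b := b + c))).mono_set Ioc_subset_Icc_self
  -- The dominating shifts see only times in [1, b + 1] and [2, b + 2], away from 0.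
  refine Integrable.mono' (((hshift 1 one_pos).const_mul 2).add (hshift 2 two_pos))
    (hg.aestronglyMeasurable.mono_set Ioc_subset_Ioi_self) ?_
  rw [ae_restrict_iff' measurableSet_Ioc]
  filter_upwards [hsol.ae_norm_weightedFourier_le hU hrep] with t ht htb
  exact ht htb.1

lemma IsDistributionalSolution.ae_eq_zero
    (hU : LocallyIntegrableOn U (Ioi (0 : ℝ)) volume) (hrep : IsRepresentedBy u U)
    (hsol : IsDistributionalSolution P 0 0 u) : ∀ᵐ t, 0 < t → U t = 0 := by
  have hG : LocallyIntegrable ((Ioi 0).indicator fun t => (U t).weightedFourier) volume :=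
    locallyIntegrable_indicator_Ioi (hsol.integrableOn_weightedFourier hU hrep)
  have h : ∀ R n : ℕ, ∀ᵐ t : ℝ, 0 < t → t < n → ballCutoff R (U t).weightedFourier = 0 := by
    intro R n
    -- Centre t - n, step n. With b = -2n the condition b + n < t - n reads 0 < t, while t < n puts
    -- the centre at negative time, where the zero extension vanishes.
    have := ae_comp_add_right (hsol.ae_norm_ballCutoff_symmetric_sum_le hrep R le_rfl
      (b := -(2 * n)) (Or.inr rfl) hG (Nat.cast_nonneg n)) (-n)
    filter_upwards [this] with t ht ht0 htn
    have h1 := ht (by linarith)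
    rw [neg_add_cancel_right, indicator_of_mem (show t ∈ Ioi (0 : ℝ) from ht0),
      indicator_of_notMem (show t + -n - n ∉ Ioi (0 : ℝ) by simp only [mem_Ioi]; linarith),
      indicator_of_notMem (show t + -n ∉ Ioi (0 : ℝ) by simp only [mem_Ioi]; linarith),
      map_zero, add_zero, norm_zero, mul_zero] at h1
    exact norm_le_zero_iff.1 h1
  have h' := ae_all_iff.2 fun R : ℕ => ae_all_iff.2 fun n : ℕ => h R n
  filter_upwards [h'] with t ht ht0
  rw [← SobolevH.weightedFourier_eq_zero_iff, ← norm_le_zero_iff]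
  refine norm_le_of_norm_ballCutoff_le fun R => ?_
  obtain ⟨n, hn⟩ := exists_nat_gt t
  rw [ht R n ht0 hn, norm_zero]

end Uniqueness

end

theorem theorem1p2 {d : ℕ} [NeZero d] (P : PeridynamicsModel) (s : ℝ)
    (u : SpaceTimeDistribution d) (U : ℝ → SobolevH d s)
    (hU : LocallyIntegrableOn U (Ioi (0 : ℝ)) volume)
    (hrep : IsRepresentedBy u U)
    (hsol : IsDistributionalSolution P 0 0 u) :
    u = 0 ∧ ∀ᵐ t ∂(volume.restrict (Ioi (0 : ℝ))), U t = 0 := by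
  have h : ∀ᵐ t ∂(volume.restrict (Ioi (0 : ℝ))), U t = 0 :=
    (ae_restrict_iff' measurableSet_Ioi).2 (hsol.ae_eq_zero hU hrep)
  refine ⟨?_, h⟩
  ext φ
  rw [(hrep φ).2, zero_apply]
  refine integral_eq_zero_of_ae (h.mono fun t ht => ?_)
  simp [ht, slicePairing]
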